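/- Let $k$ be an algebraically closed field with $\operatorname{char} k\neq 2$, let $g\ge 1$, and let $C$ be the hyperelliptic curve $y^2=f(x)$, where $f=\sum_i f_ix^i$ is monic of degree $2g+1$ with non-vanishing discriminant, completed by one point $\infty$ by means of the chart $s^2=h(t)=t\sum_{i} f_{2g+1-i}t^i$, $x=1/t$, $y=s/t^{g+1}$, $\infty=(t,s)=(0,0)$. Let $\iota(x,y)=(x,-y)$. For affine points $P_1,\dots,P_g$ of $C$ with $P_i\neq\iota(P_j)$ for $i\ne j$, the divisor $D=\sum_i P_i$ is represented by the pair $(u,v)$, where $u=\prod_i(x-x(P_i))$ and $v$ is the polynomial of degree $<g$ with $\operatorname{val}_{P_i}(v-y)\ge \operatorname{mult}_D(P_i)$ for all $i$. Coefficients of a polynomial outside its range of indices are $0$, and $S_n$ is the set of compositions $\sigma=(\sigma_1,\dots,\sigma_{|\sigma|})$ of $n$ (with $S_0$ consisting of the empty composition). Let $(u,v)$ and $(u',v')$ represent $D=\sum_{i=1}^gP_i$ and $D'=\sum_{i=1}^gP'_i$, where no $x$-coordinate of a $P_i$ is equal to one of a $P'_j$. Let $\varepsilon\in\{0,1\}$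 be the parity of $g$, $a=(3g-\varepsilon)/2$, $b=(g-2+\varepsilon)/2$, $d=(g-\varepsilon)/2$. Call a pair $(p,q)$ of polynomials *interpolating* if $\deg p\le a$, $\deg q\le b$, $p-qv\equiv 0\pmod u$ and $p-qv'\equiv0\pmod{u'}$. Put $$\kappa_{i,\ell}=\sum_{\ell\le m\le d}u_{i-d+m}\sum_{\sigma\in S_{m-\ell}}(-1)^{|\sigma|}\prod_{r=1}^{|\sigma|}u_{g-\sigma_r},\qquad \lambda_{i,j}=-v_{i-j}+\sum_{0\le\ell\le d}v_{(a-j)-\ell}\,\kappa_{i,\ell},$$ and define $\kappa'_{i,\ell},\lambda'_{i,j}$ in the same way from $(u',v')$. Let $M$ be the $g\times g$ matrix with rows $i=0,\dots,g-1$ and entries $$\kappa_{i,d}-\kappa'_{i,d},\ \dots,\ \kappa_{i,0}-\kappa'_{i,0},\ \lambda'_{i,1}-\lambda_{i,1},\ \dots,\ \lambda'_{i,b}-\lambda_{i,b},$$ and let $M_j$ be $M$ with its $j$-th column replaced by $(\lambda_{i,0}-\lambda'_{i,0})_{0\le i\le g-1}$. (1) The polynomials $p,q$ with coefficients $p_{g+i}=\det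 M_{1+i}$ $(0\le i\le d)$, $q_0=\det M$, $q_i=\det M_{1+d+i}$ $(1\le i\le b)$ and $p_i=\sum_{\ell=0}^dp_{a-\ell}\kappa_{i,\ell}-\sum_{j=1}^bq_j\lambda_{i,j}-q_0\lambda_{i,0}$ $(0\le i\le g-1)$ form an interpolating pair. (2) Let $(p,q)$ be any interpolating pair, and put $$\rho=p_a^2(1-\varepsilon)-f_{2g+1}q_b^2\varepsilon,\quad \omega_j=\sum_{i=0}^ju_iu'_{j-i},\quad \eta_n=\sum_{j=0}^n\Bigl(p_jp_{n-j}-f_{n-j}\sum_{i=0}^jq_iq_{j-i}\Bigr).$$ Suppose $\rho\ne0$. Then there is a monic polynomial $u''$ of degree $g$ with $p^2-fq^2=\rho\,u\,u'\,u''$, and: - there are affine points $Q_1,\dots,Q_g$ of $C$ with $u''=\prod_i(x-x(Q_i))$ and $[D-g\infty]+[D'-g\infty]=[\sum_iQ_i-g\infty]$ in $\operatorname{Jac}(C)=\operatorname{Pic}^0(C)$; - if $[D-g\infty]+[D'-g\infty]=[D''-g\infty]$, where $D''=\sum_{i=1}^gP''_i$ is a sum of affine points represented by a pair of polynomials as above,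 then the first polynomial of that pair is $u''$; - if $\omega_0\neq0$, the coefficients of $u''$ are, for all $j\ge0$, $$u''_j=\sum_{i=0}^j\frac{\eta_i}{\rho\,\omega_0}\sum_{\sigma\in S_{j-i}}\frac{(-1)^{|\sigma|}}{\omega_0^{|\sigma|}}\prod_{r=1}^{|\sigma|}\omega_{\sigma_r}.$$ -/

import Mathlib

open Polynomial

noncomputable section

/-- A hyperelliptic curve of genus `g` over `k` with one point at infinity, given by
`y ^ 2 = f(x)` with `f` monic of degree `2 g + 1` and of non-vanishing discriminant. -/
structure HyperellipticCurve (k : Type*) [Field k] (g : ℕ) where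
  f : k[X]
  monic : f.Monic
  natDegree_eq : f.natDegree = 2 * g + 1
  discr_ne_zero : f.discr ≠ 0

namespace HyperellipticCurve

variable {k : Type*} [Field k] {g : ℕ} (C : HyperellipticCurve k g)

/-! ### The two affine charts and the function field -/

/-- `k[x][y] / (y ^ 2 - f(x))`, the coordinate ring of the affine chart `y ^ 2 = f(x)`. -/
abbrev CoordRing : Type _ := AdjoinRoot (X ^ 2 - Polynomial.C C.f : k[X][X])

/-- The polynomial `h(t) = t (h_{2g+1} t^{2g+1} + ⋯ + h_0)` with `h_i = f_{2g+1-i}`. -/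
def h : k[X] := X * C.f.reflect (2 * g + 1)

/-- `k[t][s] / (s ^ 2 - h(t))`, the coordinate ring of the affine chart `s ^ 2 = h(t)`. -/
abbrev CoordRingInf : Type _ := AdjoinRoot (X ^ 2 - Polynomial.C C.h : k[X][X])

theorem irreducible_equation : Irreducible (X ^ 2 - Polynomial.C C.f : k[X][X]) := by
  have hm : (X ^ 2 - Polynomial.C C.f : k[X][X]).Monic := monic_X_pow_sub_C _ (by norm_num)
  have hd : (X ^ 2 - Polynomial.C C.f : k[X][X]).natDegree = 2 := natDegree_X_pow_sub_C
  rw [hm.irreducible_iff_roots_eq_zero_of_degree_le_three (by omega) (by omega),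
    Multiset.eq_zero_iff_forall_notMem]
  intro a ha
  have h1 : a ^ 2 = C.f := by
    have := (mem_roots'.1 ha).2
    simpa [IsRoot, sub_eq_zero] using this
  have h2 := congrArg natDegree h1
  rw [natDegree_pow, C.natDegree_eq] at h2
  omega

instance : IsDomain C.CoordRing :=
  AdjoinRoot.isDomain_of_prime C.irreducible_equation.prime

/-- The function field of the curve. -/
abbrev FunctionField : Type _ := FractionRing C.CoordRing

/-- A polynomial in `x`, as a rational function on the curve. -/
def ofPoly : k[X] →+* C.FunctionField :=
  (algebraMap C.CoordRing C.FunctionField).comp (AdjoinRoot.of _)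

/-- The rational function `x`. -/
def x : C.FunctionField := C.ofPoly X

/-- The rational function `y`. -/
def y : C.FunctionField := algebraMap C.CoordRing C.FunctionField (AdjoinRoot.root _)

theorem ofPoly_injective : Function.Injective C.ofPoly := by
  refine (IsFractionRing.injective C.CoordRing C.FunctionField).comp ?_
  refine AdjoinRoot.of.injective_of_degree_ne_zero ?_
  rw [degree_X_pow_sub_C (by norm_num)]
  norm_num

theorem x_ne_zero : C.x ≠ 0 := by
  intro h0
  exact X_ne_zero (C.ofPoly_injective (h0.trans (map_zero _).symm))

theorem y_sq : C.y ^ 2 = C.ofPoly C.f := by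
  have h1 : (AdjoinRoot.root (X ^ 2 - Polynomial.C C.f : k[X][X])) ^ 2
      = AdjoinRoot.of _ C.f := by
    have := AdjoinRoot.eval₂_root (X ^ 2 - Polynomial.C C.f : k[X][X])
    simpa [sub_eq_zero] using this
  simp only [y, ofPoly, RingHom.comp_apply, ← map_pow, h1]

theorem gluing_relation :
    (X ^ 2 - Polynomial.C C.h : k[X][X]).eval₂
      (eval₂RingHom (C.ofPoly.comp Polynomial.C) C.x⁻¹) (C.y / C.x ^ (g + 1)) = 0 := by
  have hx := C.x_ne_zero
  let _ : Invertible C.x := invertibleOfNonzero hx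
  have h1 := eval₂_reflect_mul_pow (C.ofPoly.comp Polynomial.C) C.x (2 * g + 1) C.f
    C.natDegree_eq.le
  have h2 : eval₂ (C.ofPoly.comp Polynomial.C) C.x C.f = C.ofPoly C.f := by
    have := hom_eval₂ C.f Polynomial.C C.ofPoly X
    rw [eval₂_C_X] at this
    exact this.symm
  rw [h2, ← C.y_sq, invOf_eq_inv] at h1
  simp only [eval₂_sub, eval₂_X_pow, eval₂_C, coe_eval₂RingHom, h, eval₂_mul, eval₂_X]
  rw [div_pow, ← h1]
  field_simp
  ring

/-- The gluing of the two charts: the regular functions on the chart `s ^ 2 = h(t)` are rational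
functions on the curve through `t = 1 / x` and `s = y / x ^ (g + 1)`. -/
def infToFunctionField : C.CoordRingInf →+* C.FunctionField :=
  AdjoinRoot.lift (eval₂RingHom (C.ofPoly.comp Polynomial.C) C.x⁻¹) (C.y / C.x ^ (g + 1))
    C.gluing_relation

/-! ### Points and orders of vanishing -/

/-- A point of the affine chart `y ^ 2 = f(x)`. -/
@[ext]
structure AffinePoint where
  x : k
  y : k
  equation : y ^ 2 = C.f.eval x

/-- The hyperelliptic involution `(x, y) ↦ (x, -y)` on affine points. -/
def AffinePoint.conj {C : HyperellipticCurve k g} (P : C.AffinePoint) : C.AffinePoint :=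
  ⟨P.x, -P.y, by rw [neg_sq]; exact P.equation⟩

/-- A point of the curve: an affine point, or the point `∞`, which is `(t, s) = (0, 0)` in the
other chart. -/
inductive Point where
  | affine (P : C.AffinePoint)
  | infinity

/-- The maximal ideal `(x - x(P), y - y(P))` of an affine point. -/
def maxIdeal (P : C.AffinePoint) : Ideal C.CoordRing :=
  Ideal.span {AdjoinRoot.of _ (X - Polynomial.C P.x),
    AdjoinRoot.root _ - AdjoinRoot.of _ (Polynomial.C P.y)}

/-- The maximal ideal `(t, s)` of the point `∞`. -/
def maxIdealInf : Ideal C.CoordRingInf :=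
  Ideal.span {AdjoinRoot.of _ X, AdjoinRoot.root _}

/-- `φ` has order `n` along the ideal `m` of `A`: it is a quotient `a / b` of elements of `A` such
that `a` lies in exactly the `i`-th power of `m`, `b` in exactly the `j`-th, and `n = i - j`. -/
def HasOrdAlong {A K : Type*} [CommRing A] [CommRing K] (ι : A →+* K) (m : Ideal A)
    (φ : K) (n : ℤ) : Prop :=
  ∃ (a b : A) (i j : ℕ), a ∈ m ^ i ∧ a ∉ m ^ (i + 1) ∧ b ∈ m ^ j ∧ b ∉ m ^ (j + 1) ∧
    φ * ι b = ι a ∧ n = (i : ℤ) - j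

/-- `val_P(φ) = n` for a rational function `φ` (and a point `P` of the curve, at which the curve
is smooth). -/
def HasOrd : C.Point → C.FunctionField → ℤ → Prop
  | .affine P => HasOrdAlong (algebraMap C.CoordRing C.FunctionField) (C.maxIdeal P)
  | .infinity => HasOrdAlong C.infToFunctionField C.maxIdealInf

/-! ### Divisors and the Jacobian -/

/-- Divisors on the curve. -/
abbrev Divisor : Type _ := C.Point →₀ ℤ

/-- Divisors of degree zero. -/
def divisorZero : AddSubgroup C.Divisor :=
  (Finsupp.degree : C.Divisor →+ ℤ).ker

/-- `E` is the divisor of a nonzero rational function. -/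
def IsDivOfFunction (E : C.Divisor) : Prop :=
  ∃ φ : C.FunctionField, φ ≠ 0 ∧ ∀ P : C.Point, C.HasOrd P φ (E P)

/-- The group of principal divisors. -/
def principalDivisors : AddSubgroup C.Divisor :=
  AddSubgroup.closure {E | C.IsDivOfFunction E}

/-- `Jac(C) = Pic⁰(C)`: divisors of degree zero modulo principal divisors. -/
abbrev Jac : Type _ := C.divisorZero ⧸ C.principalDivisors.addSubgroupOf C.divisorZero

/-- The divisor `P_1 + ⋯ + P_g`. -/
def sumDivisor (P : Fin g → C.AffinePoint) : C.Divisor :=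
  ∑ i, Finsupp.single (Point.affine (P i)) 1

theorem sumDivisor_sub_mem (P : Fin g → C.AffinePoint) :
    C.sumDivisor P - Finsupp.single Point.infinity (g : ℤ) ∈ C.divisorZero := by
  simp [divisorZero, AddMonoidHom.mem_ker, sumDivisor, map_sub, map_sum, Finsupp.degree_single]

/-- The class `[P_1 + ⋯ + P_g - g ∞]`. -/
def jacClass (P : Fin g → C.AffinePoint) : C.Jac :=
  QuotientAddGroup.mk ⟨_, C.sumDivisor_sub_mem P⟩

/-- `(u, v)` is the pair of polynomials representing the divisor `D = P_1 + ⋯ + P_g`: no two of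
the summands are conjugate, `u` is the monic polynomial with roots the `x`-coordinates of the
summands, and `v` is the polynomial of degree less than `g` that approximates `y` to order at
least `mult(P_i)` at each `P_i`. -/
structure Represents (P : Fin g → C.AffinePoint) (u v : k[X]) : Prop where
  not_conj : ∀ i j, i ≠ j → P i ≠ (P j).conj
  u_eq : u = ∏ i, (X - Polynomial.C (P i).x)
  v_degree : v.degree < g
  v_approx : ∀ i, ∃ n : ℤ, C.sumDivisor P (.affine (P i)) ≤ n ∧
    C.HasOrd (.affine (P i)) (C.ofPoly v - C.y) n

end HyperellipticCurve

/-! ### The interpolation function `p / q` -/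

namespace JacobianAddition

variable {k : Type*} [Field k]

/-- `ε`, the parity of `g`. -/
def parity (g : ℕ) : ℕ := g % 2

/-- `a = (3 g - ε) / 2` -/
def a (g : ℕ) : ℕ := (3 * g - parity g) / 2

/-- `b = (g - 2 + ε) / 2`, for `g` positive -/
def b (g : ℕ) : ℕ := (g + parity g - 2) / 2

/-- `d = (g - ε) / 2` -/
def d (g : ℕ) : ℕ := (g - parity g) / 2

/-- The coefficient of a polynomial at an integer index, zero at negative indices. -/
def coeffZ (r : k[X]) (i : ℤ) : k := if 0 ≤ i then r.coeff i.toNat else 0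

/-- `κ_{i,ℓ}` -/
def kappa (g : ℕ) (u : k[X]) (i l : ℕ) : k :=
  ∑ m ∈ Finset.Icc l (d g), coeffZ u ((i : ℤ) - d g + m) *
    ∑ σ : Composition (m - l), (-1) ^ σ.length *
      ∏ r : Fin σ.length, coeffZ u ((g : ℤ) - σ.blocksFun r)

/-- `λ_{i,j}` -/
def lam (g : ℕ) (u v : k[X]) (i j : ℕ) : k :=
  -coeffZ v ((i : ℤ) - j) +
    ∑ l ∈ Finset.range (d g + 1), coeffZ v ((a g : ℤ) - j - l) * kappa g u i l

/-- The matrix `M`. Its columns, counted from zero, are `κ_{·,d-c} - κ'_{·,d-c}` for `c ≤ d` and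
`λ'_{·,j} - λ_{·,j}` for `c = d + j` with `1 ≤ j ≤ b`. -/
def matM (g : ℕ) (u v u' v' : k[X]) : Matrix (Fin g) (Fin g) k :=
  Matrix.of fun i c =>
    if (c : ℕ) ≤ d g then kappa g u i (d g - c) - kappa g u' i (d g - c)
    else lam g u' v' i (c - d g) - lam g u v i (c - d g)

/-- The right-hand side `λ_{i,0} - λ'_{i,0}` of the linear system. -/
def rhs (g : ℕ) (u v u' v' : k[X]) : Fin g → k :=
  fun i => lam g u v i 0 - lam g u' v' i 0

/-- The determinant of `M` with its column `c` (counted from zero) replaced by the right-hand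
side. -/
def detM (g : ℕ) (u v u' v' : k[X]) (c : ℕ) : k :=
  if hc : c < g then ((matM g u v u' v').updateCol ⟨c, hc⟩ (rhs g u v u' v')).det else 0

/-- The numerator `p` given by the determinant formulas. -/
def detP (g : ℕ) (u v u' v' : k[X]) : k[X] :=
  (∑ i ∈ Finset.range g, Polynomial.C (
      (∑ l ∈ Finset.range (d g + 1), detM g u v u' v' (d g - l) * kappa g u i l)
      - (∑ j ∈ Finset.Icc 1 (b g), detM g u v u' v' (d g + j) * lam g u v i j)
      - (matM g u v u' v').det * lam g u v i 0) * X ^ i)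
  + ∑ i ∈ Finset.range (d g + 1), Polynomial.C (detM g u v u' v' i) * X ^ (g + i)

/-- The denominator `q` given by the determinant formulas. -/
def detQ (g : ℕ) (u v u' v' : k[X]) : k[X] :=
  Polynomial.C (matM g u v u' v').det
  + ∑ j ∈ Finset.Icc 1 (b g), Polynomial.C (detM g u v u' v' (d g + j)) * X ^ j

/-- `p / q` has the form `(p_a x^a + ⋯ + p_0) / (q_b x^b + ⋯ + q_0)` and satisfies the
interpolation conditions `p - q v ≡ 0 (mod u)` and `p - q v' ≡ 0 (mod u')`. -/
structure Interpolates (g : ℕ) (u v u' v' p q : k[X]) : Prop where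
  p_deg : p.natDegree ≤ a g
  q_deg : q.natDegree ≤ b g
  dvd : u ∣ p - q * v
  dvd' : u' ∣ p - q * v'

/-! ### The quantities `ρ`, `ω_j`, `η_k` -/

/-- `ρ = p_a² (1 - ε) - f_{2g+1} q_b² ε` -/
def rho (g : ℕ) (f p q : k[X]) : k :=
  p.coeff (a g) ^ 2 * (1 - (parity g : k)) - f.coeff (2 * g + 1) * q.coeff (b g) ^ 2 * (parity g : k)

/-- `ω_j` -/
def omega (u u' : k[X]) (j : ℕ) : k :=
  ∑ i ∈ Finset.range (j + 1), u.coeff i * u'.coeff (j - i)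

/-- `η_n` -/
def eta (f p q : k[X]) (n : ℕ) : k :=
  ∑ j ∈ Finset.range (n + 1), (p.coeff j * p.coeff (n - j) -
    f.coeff (n - j) * ∑ i ∈ Finset.range (j + 1), q.coeff i * q.coeff (j - i))

end JacobianAddition

end

/-! The group law is read off the divisor of the function p - qy, whose norm to k(x) is N = p^2 - f
q^2. The identity p - qy = (p - qv) + q(v - y) shows that it vanishes on D, likewise on D', and
hence on D + D', as the supports are disjoint. The bounds a and b on the degrees give deg N ≤ 3g,
and ρ is the coefficient of x^{3g}. If ρ ≠ 0, the only pole is of order 3g at ∞, and the zeros are D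
+ D' + E with E effective of degree g. As E + ιE ~ 2g∞, the sum of the two classes is that of ιE -
g∞. The roots of N are the x-coordinates of the zeros, so N = ρ u u' u'' with u'' belonging to ιE
(`exists_sum`).

For uniqueness (`eq_of_reduced`), let D'' ~ ιE with D'' reduced. Then D'' + E - 2g∞ is the divisor
of a function regular on the affine chart, thus of some r + wy. Since y has a pole of order 2g + 1,
w = 0. The divisor of r(x) is ι-invariant, which forces D'' = ιE because D'' contains no pair of
conjugate points.

For the determinants, -κ and -λ are the coefficients of the remainders of x^{a-ℓ} and x^j v modulo
u. Interpolation says that the low coefficients of p computed modulo u and modulo u' agree, a linear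
system with matrix M. Cramer's rule in the form M · cramer = det M · rhs solves it even if det M =
0. The sums over compositions, in κ and in the coefficients of u'', are coefficients of inverse
power series (`weightSum_succ`).

Orders are manageable because both charts are double covers y^2 = F(x) with F free of double roots.
In characteristic other than 2 their coordinate rings are Dedekind, and `HasOrdAlong` becomes a
discrete valuation (`hasOrdAlong_iff`). -/

noncomputable section

/-! ### Double covers `y ^ 2 = F(x)` of the affine line -/

namespace DoubleCover

variable {k : Type*} [Field k] (F : k[X])

/-- The coordinate ring of `y ^ 2 = F(x)`. -/
abbrev Ring : Type _ := AdjoinRoot (X ^ 2 - C F : k[X][X])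

/-- A polynomial in `x`, as a function on the double cover. -/
abbrev ofX : k[X] →+* Ring F := AdjoinRoot.of _

/-- The function `y`. -/
abbrev y : Ring F := AdjoinRoot.root _

theorem y_sq : y F ^ 2 = ofX F F := by
  have := AdjoinRoot.eval₂_root (X ^ 2 - C F : k[X][X])
  simpa [sub_eq_zero] using this

theorem ofX_injective : Function.Injective (ofX F) := by
  refine AdjoinRoot.of.injective_of_degree_ne_zero ?_
  rw [degree_X_pow_sub_C (by norm_num)]
  norm_num

theorem exists_eq_add_mul_y (z : Ring F) : ∃ r w : k[X], z = ofX F r + ofX F w * y F := by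
  have hm : (X ^ 2 - C F : k[X][X]).Monic := monic_X_pow_sub_C _ (by norm_num)
  obtain ⟨p, rfl⟩ := AdjoinRoot.mk_surjective z
  have h1 : AdjoinRoot.mk (X ^ 2 - C F : k[X][X]) p
      = AdjoinRoot.mk _ (p %ₘ (X ^ 2 - C F : k[X][X])) := by
    conv_lhs => rw [← modByMonic_add_div p (X ^ 2 - C F : k[X][X])]
    simp
  have h2 : (p %ₘ (X ^ 2 - C F : k[X][X])).natDegree ≤ 1 := by
    have h := natDegree_modByMonic_lt p hm (by
      intro h; have := congrArg natDegree h; rw [natDegree_X_pow_sub_C] at this; simp at this)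
    rw [natDegree_X_pow_sub_C] at h
    omega
  obtain ⟨w, r, h3⟩ := exists_eq_X_add_C_of_natDegree_le_one h2
  refine ⟨r, w, ?_⟩
  rw [h1, h3]
  simp [add_comm]

theorem mul_conj (r w : k[X]) :
    (ofX F r + ofX F w * y F) * (ofX F r - ofX F w * y F) = ofX F (r ^ 2 - F * w ^ 2) := by
  have := y_sq F
  simp only [map_sub, map_mul, map_pow, ← this]
  ring

/-- The involution `y ↦ -y`, as a ring homomorphism. -/
def conjHom : Ring F →+* Ring F :=
  AdjoinRoot.lift (ofX F) (-y F) (by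
    have := y_sq F
    simp only [eval₂_sub, eval₂_X_pow, eval₂_C, neg_sq]
    rw [this, sub_self])

@[simp] theorem conjHom_ofX (r : k[X]) : conjHom F (ofX F r) = ofX F r :=
  AdjoinRoot.lift_of _

@[simp] theorem conjHom_y : conjHom F (y F) = -y F := AdjoinRoot.lift_root _

theorem conjHom_conjHom (z : Ring F) : conjHom F (conjHom F z) = z := by
  obtain ⟨r, w, rfl⟩ := exists_eq_add_mul_y F z
  simp

/-- The involution `y ↦ -y`. -/
def conj : Ring F ≃+* Ring F :=
  RingEquiv.ofRingHom (conjHom F) (conjHom F)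
    (RingHom.ext (conjHom_conjHom F)) (RingHom.ext (conjHom_conjHom F))

@[simp] theorem conj_ofX (r : k[X]) : conj F (ofX F r) = ofX F r := conjHom_ofX F r

@[simp] theorem conj_y : conj F (y F) = -y F := conjHom_y F

/-- The ideal `(x - a, y - b)`. -/
def pointIdeal (a b : k) : Ideal (Ring F) :=
  Ideal.span {ofX F (X - C a), y F - ofX F (C b)}

theorem map_conj_pointIdeal (a b : k) :
    (pointIdeal F a b).map (conj F) = pointIdeal F a (-b) := by
  rw [pointIdeal, Ideal.map_span, Set.image_pair]
  simp only [conj_ofX, map_sub, conj_y, pointIdeal, map_neg]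
  rw [Ideal.span_insert, Ideal.span_insert, ← Ideal.span_singleton_neg (-y F - _)]
  congr 3
  ring

/-! ### Points of a double cover as maximal ideals -/

variable {F} {a b : k}

/-- Evaluation at the point `(a, b)`. -/
def evalAt (h : b ^ 2 = F.eval a) : Ring F →+* k :=
  AdjoinRoot.lift (evalRingHom a) b (by simp [h])

@[simp] theorem evalAt_ofX (h : b ^ 2 = F.eval a) (r : k[X]) : evalAt h (ofX F r) = r.eval a :=
  AdjoinRoot.lift_of _

@[simp] theorem evalAt_y (h : b ^ 2 = F.eval a) : evalAt h (y F) = b :=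
  AdjoinRoot.lift_root _

theorem ofX_sub_mem (r : k[X]) : ofX F r - ofX F (C (r.eval a)) ∈ pointIdeal F a b := by
  obtain ⟨s, hs⟩ := X_sub_C_dvd_sub_C_eval (a := a) (p := r)
  rw [← map_sub, hs, map_mul]
  exact Ideal.mul_mem_right _ _ (Ideal.subset_span (by simp))

theorem y_sub_mem : y F - ofX F (C b) ∈ pointIdeal F a b := Ideal.subset_span (by simp)

theorem ofX_X_sub_mem : ofX F (X - C a) ∈ pointIdeal F a b := Ideal.subset_span (by simp)

theorem mem_pointIdeal_iff (h : b ^ 2 = F.eval a) {z : Ring F} :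
    z ∈ pointIdeal F a b ↔ evalAt h z = 0 := by
  constructor
  · intro hz
    have : pointIdeal F a b ≤ RingHom.ker (evalAt h) := by
      rw [pointIdeal, Ideal.span_le]
      rintro _ (rfl | rfl)
      · simp [RingHom.mem_ker]
      · simp [RingHom.mem_ker]
    exact this hz
  · intro hz
    obtain ⟨r, w, rfl⟩ := exists_eq_add_mul_y F z
    simp only [map_add, map_mul, evalAt_ofX, evalAt_y] at hz
    -- Replace r and w by their values at a, and y by b: each change lies in the ideal, and the
    -- constant left over is the value of z, which is 0.
    have h1 : ofX F r + ofX F w * y F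
        = (ofX F r - ofX F (C (r.eval a))) + (ofX F w - ofX F (C (w.eval a))) * y F
          + ofX F (C (w.eval a)) * (y F - ofX F (C b)) := by
      have : ofX F (C (r.eval a)) + ofX F (C (w.eval a)) * ofX F (C b) = 0 := by
        rw [← map_mul, ← map_add, ← C_mul, ← C_add, hz]; simp
      linear_combination this
    rw [h1]
    exact add_mem (add_mem (ofX_sub_mem r) (Ideal.mul_mem_right _ _ (ofX_sub_mem w)))
      (Ideal.mul_mem_left _ _ y_sub_mem)

theorem pointIdeal_eq_ker (h : b ^ 2 = F.eval a) : pointIdeal F a b = RingHom.ker (evalAt h) :=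
  Ideal.ext fun _ => (mem_pointIdeal_iff h).trans RingHom.mem_ker.symm

theorem pointIdeal_isMaximal (h : b ^ 2 = F.eval a) : (pointIdeal F a b).IsMaximal := by
  rw [pointIdeal_eq_ker h]
  exact RingHom.ker_isMaximal_of_surjective _ fun c => ⟨ofX F (C c), by simp⟩

theorem ofX_X_sub_ne_zero : ofX F (X - C a) ≠ 0 := by
  rw [Ne, map_eq_zero_iff _ (ofX_injective F)]
  exact X_sub_C_ne_zero a

theorem pointIdeal_ne_bot : pointIdeal F a b ≠ ⊥ := fun h =>
  ofX_X_sub_ne_zero (F := F) (a := a) ((Submodule.eq_bot_iff _).1 h _ ofX_X_sub_mem)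

/-- The equation of the curve, expanded at a point. -/
theorem y_sub_mul_y_add (h : b ^ 2 = F.eval a) :
    ∃ s : k[X], F - C (F.eval a) = (X - C a) * s ∧
      (y F - ofX F (C b)) * (y F + ofX F (C b)) = ofX F (X - C a) * ofX F s := by
  obtain ⟨s, hs⟩ := X_sub_C_dvd_sub_C_eval (a := a) (p := F)
  refine ⟨s, hs, ?_⟩
  rw [← map_mul, ← hs, ← h, map_sub, ← y_sq, C_pow, map_pow]
  ring

/-- The curve `y ^ 2 = F(x)` is smooth when `F` has no double root. -/
def NoDoubleRoot (F : k[X]) : Prop := ∀ a : k, ¬ (X - C a) ^ 2 ∣ F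

theorem eval_ne_zero_of_noDoubleRoot (hF : NoDoubleRoot F) {s : k[X]} (ha : F.eval a = 0)
    (hs : F - C (F.eval a) = (X - C a) * s) : s.eval a ≠ 0 := by
  intro h
  obtain ⟨t, rfl⟩ := dvd_iff_isRoot.2 h
  refine hF a ⟨t, ?_⟩
  rw [ha, C_0, sub_zero] at hs
  rw [hs]; ring

variable [IsAlgClosed k]

/-- The norm of a nonzero element of p is a nonzero polynomial in x lying in p. It splits over k, so
p contains some x - a, and then y - b or y + b because their product is a multiple of x - a. -/
theorem eq_pointIdeal_of_isPrime [IsDomain (Ring F)] {p : Ideal (Ring F)} (hp : p ≠ ⊥)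
    (hp' : p.IsPrime) : ∃ a b : k, b ^ 2 = F.eval a ∧ p = pointIdeal F a b := by
  obtain ⟨z, hz, hz0⟩ := Submodule.exists_mem_ne_zero_of_ne_bot hp
  obtain ⟨r, w, rfl⟩ := exists_eq_add_mul_y F z
  have hN : ofX F (r ^ 2 - F * w ^ 2) ∈ p := by
    rw [← mul_conj]; exact Ideal.mul_mem_right _ _ hz
  have hN0 : r ^ 2 - F * w ^ 2 ≠ 0 := by
    intro h
    have h1 := mul_conj F r w
    rw [h, map_zero] at h1
    rcases mul_eq_zero.1 h1 with h2 | h2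
    · exact hz0 h2
    · apply hz0
      have := congrArg (conj F) h2
      simpa using this
  have key : ∀ n : ℕ, ∀ N : k[X], N.natDegree = n → N ≠ 0 → ofX F N ∈ p →
      ∃ a, ofX F (X - C a) ∈ p := by
    intro n
    induction n with
    | zero =>
      intro N hd h0 hm
      rw [eq_C_of_natDegree_eq_zero hd] at hm h0
      exfalso
      refine hp'.ne_top (Ideal.eq_top_of_isUnit_mem _ hm ?_)
      exact (isUnit_C.2 (isUnit_iff_ne_zero.2 (by simpa using h0))).map _
    | succ n ih =>
      intro N hd h0 hm
      obtain ⟨a, ha⟩ := IsAlgClosed.exists_root N (by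
        rw [degree_eq_natDegree h0, hd]; exact_mod_cast Nat.succ_ne_zero n)
      obtain ⟨N', rfl⟩ := dvd_iff_isRoot.2 ha
      rw [map_mul] at hm
      rcases hp'.mem_or_mem hm with h | h
      · exact ⟨a, h⟩
      · have h0' := right_ne_zero_of_mul h0
        rw [natDegree_mul (X_sub_C_ne_zero a) h0', natDegree_X_sub_C] at hd
        exact ih N' (by omega) h0' h
  obtain ⟨a, ha⟩ := key _ _ rfl hN0 hN
  obtain ⟨b, hb⟩ := IsAlgClosed.exists_pow_nat_eq (F.eval a) (n := 2) (by norm_num)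
  obtain ⟨s, -, hs⟩ := y_sub_mul_y_add hb
  have h1 : (y F - ofX F (C b)) * (y F + ofX F (C b)) ∈ p := by
    rw [hs]; exact Ideal.mul_mem_right _ _ ha
  have main : ∀ c : k, c ^ 2 = F.eval a → y F - ofX F (C c) ∈ p → p = pointIdeal F a c := by
    intro c hc h
    refine ((pointIdeal_isMaximal hc).eq_of_le hp'.ne_top ?_).symm
    rw [pointIdeal, Ideal.span_le]
    rintro _ (rfl | rfl)
    exacts [ha, h]
  rcases hp'.mem_or_mem h1 with h | h
  · exact ⟨a, b, hb, main b hb h⟩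
  · refine ⟨a, -b, by rw [neg_sq, hb], main (-b) (by rw [neg_sq, hb]) ?_⟩
    simpa using h

end DoubleCover

/-! ### Smooth double covers are Dedekind; valuations of x - a and y at a point -/

namespace DoubleCover

open IsDedekindDomain IsLocalRing

variable {k : Type*} [Field k] {F : k[X]} {a b : k}

/-- In (y - b)(y + b) = (x - a) s one factor is a local unit: s if b = 0, because a is a simple root
of F, and y + b otherwise, because 2b ≠ 0. So y, respectively x - a, generates the ideal locally. -/
theorem map_pointIdeal_isPrincipal (h2 : (2 : k) ≠ 0) (hF : NoDoubleRoot F)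
    (h : b ^ 2 = F.eval a) (S : Type*) [CommRing S] [Algebra (Ring F) S]
    [(pointIdeal F a b).IsPrime] [IsLocalization.AtPrime S (pointIdeal F a b)] :
    ((pointIdeal F a b).map (algebraMap (Ring F) S)).IsPrincipal := by
  have hunit : ∀ z : Ring F, evalAt h z ≠ 0 → IsUnit (algebraMap (Ring F) S z) := by
    intro z hz
    exact IsLocalization.map_units S (⟨z, fun hm => hz ((mem_pointIdeal_iff h).1 hm)⟩ :
      (pointIdeal F a b).primeCompl)
  obtain ⟨s, hs, hrel⟩ := y_sub_mul_y_add h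
  have hrel' := congrArg (algebraMap (Ring F) S) hrel
  simp only [map_mul (algebraMap (Ring F) S)] at hrel'
  have hmap : (pointIdeal F a b).map (algebraMap (Ring F) S) =
      Ideal.span {algebraMap (Ring F) S (ofX F (X - C a)),
        algebraMap (Ring F) S (y F - ofX F (C b))} := by
    rw [pointIdeal, Ideal.map_span, Set.image_pair]
  rw [hmap]
  by_cases hb : b = 0
  · subst hb
    refine ⟨⟨algebraMap (Ring F) S (y F - ofX F (C 0)), ?_⟩⟩
    have hs0 := eval_ne_zero_of_noDoubleRoot hF (by rw [← h]; simp) hs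
    obtain ⟨e, he⟩ := hunit (ofX F s) (by simpa using hs0)
    rw [Ideal.submodule_span_eq]
    refine le_antisymm (Ideal.span_le.2 ?_) (Ideal.span_mono (by simp))
    rintro _ (rfl | rfl)
    · refine Ideal.mem_span_singleton.2 ⟨algebraMap (Ring F) S (y F + ofX F (C 0)) * ↑e⁻¹, ?_⟩
      rw [← mul_assoc, hrel', ← he, mul_assoc, Units.mul_inv, mul_one]
    · exact Ideal.mem_span_singleton_self _
  · refine ⟨⟨algebraMap (Ring F) S (ofX F (X - C a)), ?_⟩⟩
    obtain ⟨e, he⟩ := hunit (y F + ofX F (C b)) (by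
      simp only [map_add, evalAt_y, evalAt_ofX, eval_C, ← two_mul]
      exact mul_ne_zero h2 hb)
    rw [Ideal.submodule_span_eq]
    refine le_antisymm (Ideal.span_le.2 ?_) (Ideal.span_mono (by simp))
    rintro _ (rfl | rfl)
    · exact Ideal.mem_span_singleton_self _
    · refine Ideal.mem_span_singleton.2 ⟨algebraMap (Ring F) S (ofX F s) * ↑e⁻¹, ?_⟩
      rw [← mul_assoc, ← hrel', ← he, mul_assoc, Units.mul_inv, mul_one]

theorem isDedekindDomain [IsAlgClosed k] [IsDomain (Ring F)] (h2 : (2 : k) ≠ 0)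
    (hF : NoDoubleRoot F) : IsDedekindDomain (Ring F) := by
  have : IsDedekindDomainDvr (Ring F) := by
    refine { is_dvr_at_nonzero_prime := fun p hp hp' => ?_ }
    obtain ⟨a, b, h, rfl⟩ := eq_pointIdeal_of_isPrime hp hp'
    have h1 := map_pointIdeal_isPrincipal h2 hF h (Localization.AtPrime (pointIdeal F a b))
    rw [Localization.AtPrime.map_eq_maximalIdeal] at h1
    have hnf : ¬ IsField (Localization.AtPrime (pointIdeal F a b)) :=
      IsLocalization.AtPrime.not_isField (Ring F) hp _
    have : IsNoetherianRing (Localization.AtPrime (pointIdeal F a b)) :=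
      IsLocalization.isNoetherianRing (pointIdeal F a b).primeCompl _ inferInstance
    exact ((IsDiscreteValuationRing.TFAE _ hnf).out 0 4).2 h1
  infer_instance

/-- The point `(a, b)` as a prime of the coordinate ring. -/
def prime (h : b ^ 2 = F.eval a) : HeightOneSpectrum (Ring F) where
  asIdeal := pointIdeal F a b
  isPrime := (pointIdeal_isMaximal h).isPrime
  ne_bot := pointIdeal_ne_bot

theorem mem_pow_iff_conj (h : b ^ 2 = F.eval a) (h' : (-b) ^ 2 = F.eval a) (n : ℕ)
    (z : Ring F) : conj F z ∈ (prime h').asIdeal ^ n ↔ z ∈ (prime h).asIdeal ^ n := by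
  change conj F z ∈ pointIdeal F a (-b) ^ n ↔ z ∈ pointIdeal F a b ^ n
  rw [← map_conj_pointIdeal, ← Ideal.map_pow]
  rw [Ideal.mem_map_of_equiv]
  exact ⟨fun ⟨w, hw, e⟩ => (conj F).injective e ▸ hw, fun hz => ⟨z, hz, rfl⟩⟩

variable [IsDedekindDomain (Ring F)]

theorem intValuation_eq_one (h : b ^ 2 = F.eval a) {z : Ring F} (hz : evalAt h z ≠ 0) :
    (prime h).intValuation z = 1 := by
  rw [HeightOneSpectrum.intValuation_eq_one_iff_mem_primeCompl]
  exact fun hm => hz ((mem_pointIdeal_iff h).1 hm)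

/-- Some uniformizer is a combination of the two generators of the ideal, so a member of the ideal
that vanishes to no higher order than either generator is itself a uniformizer. -/
theorem intValuation_eq_exp_neg_one_of_forall_le (h : b ^ 2 = F.eval a) {z : Ring F}
    (hz : z ∈ pointIdeal F a b)
    (h1 : (prime h).intValuation (ofX F (X - C a)) ≤ (prime h).intValuation z)
    (h2 : (prime h).intValuation (y F - ofX F (C b)) ≤ (prime h).intValuation z) :
    (prime h).intValuation z = WithZero.exp (-1) := by
  apply le_antisymm
  · have := ((prime h).intValuation_le_pow_iff_mem z 1).2 (by rw [pow_one]; exact hz)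
    exact_mod_cast this
  · obtain ⟨π, hπ⟩ := (prime h).intValuation_exists_uniformizer
    rw [← hπ]
    have hm : π ∈ pointIdeal F a b := by
      refine ((prime h).intValuation_lt_one_iff_mem π).1 ?_
      rw [hπ, ← WithZero.exp_zero, WithZero.exp_lt_exp]; norm_num
    obtain ⟨c, d, rfl⟩ := Ideal.mem_span_pair.1 hm
    refine ((prime h).intValuation.map_add _ _).trans (max_le ?_ ?_)
    · rw [map_mul]
      exact (mul_le_of_le_one_left' ((prime h).intValuation_le_one c)).trans h1
    · rw [map_mul]
      exact (mul_le_of_le_one_left' ((prime h).intValuation_le_one d)).trans h2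

theorem intValuation_X_sub_of_ne_zero (h2 : (2 : k) ≠ 0) (h : b ^ 2 = F.eval a) (hb : b ≠ 0) :
    (prime h).intValuation (ofX F (X - C a)) = WithZero.exp (-1) := by
  refine intValuation_eq_exp_neg_one_of_forall_le h ofX_X_sub_mem le_rfl ?_
  obtain ⟨s, hs, hrel⟩ := y_sub_mul_y_add h
  have h1 := congrArg (prime h).intValuation hrel
  rw [map_mul (prime h).intValuation, map_mul (prime h).intValuation,
    intValuation_eq_one h (z := y F + ofX F (C b)) (by
      simp only [map_add, evalAt_y, evalAt_ofX, eval_C, ← two_mul]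
      exact mul_ne_zero h2 hb), mul_one] at h1
  rw [h1]
  exact mul_le_of_le_one_right' ((prime h).intValuation_le_one _)

theorem intValuation_y_sq (hF : NoDoubleRoot F) (h : (0 : k) ^ 2 = F.eval a) :
    (prime h).intValuation (y F) ^ 2 = (prime h).intValuation (ofX F (X - C a)) := by
  obtain ⟨s, hs, hrel⟩ := y_sub_mul_y_add h
  have h1 := congrArg (prime h).intValuation hrel
  have hs0 := eval_ne_zero_of_noDoubleRoot hF (by rw [← h]; simp) hs
  rw [map_mul (prime h).intValuation, map_mul (prime h).intValuation,
    intValuation_eq_one h (z := ofX F s) (by simpa using hs0), mul_one] at h1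
  rw [← h1, sq]
  simp

theorem intValuation_y (hF : NoDoubleRoot F) (h : (0 : k) ^ 2 = F.eval a) :
    (prime h).intValuation (y F) = WithZero.exp (-1) := by
  refine intValuation_eq_exp_neg_one_of_forall_le h ?_ ?_ ?_
  · simpa using y_sub_mem (F := F) (a := a) (b := 0)
  · rw [← intValuation_y_sq hF h, sq]
    exact mul_le_of_le_one_left' ((prime h).intValuation_le_one _)
  · simp

theorem intValuation_X_sub_of_eq_zero (hF : NoDoubleRoot F) (h : (0 : k) ^ 2 = F.eval a) :
    (prime h).intValuation (ofX F (X - C a)) = WithZero.exp (-2) := by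
  rw [← intValuation_y_sq hF h, intValuation_y hF h, ← WithZero.exp_nsmul]
  rfl

end DoubleCover

/-! ### Integer-valued orders along a prime of a Dedekind domain -/

namespace IsDedekindDomain.HeightOneSpectrum

variable {R : Type*} [CommRing R] [IsDedekindDomain R] (v : HeightOneSpectrum R)
  {K : Type*} [Field K] [Algebra R K] [IsFractionRing R K]

/-- The order of vanishing of an element of the fraction field, with junk value `0` at `0`. -/
def ord (φ : K) : ℤ := -(v.valuation K φ).log

variable {v} {φ ψ : K}

theorem valuation_eq_exp_neg_ord (h : φ ≠ 0) : v.valuation K φ = WithZero.exp (-v.ord φ) := by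
  rw [ord, neg_neg, WithZero.exp_log]
  exact (Valuation.ne_zero_iff _).2 h

theorem ord_eq_of_valuation {n : ℤ} (h : v.valuation K φ = WithZero.exp (-n)) :
    v.ord φ = n := by
  rw [ord, h, WithZero.log_exp, neg_neg]

theorem ord_mul (h : φ ≠ 0) (h' : ψ ≠ 0) : v.ord (φ * ψ) = v.ord φ + v.ord ψ := by
  rw [ord, map_mul, WithZero.log_mul ((Valuation.ne_zero_iff _).2 h)
    ((Valuation.ne_zero_iff _).2 h'), neg_add]
  rfl

@[simp] theorem ord_one : v.ord (1 : K) = 0 := by simp [ord]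

theorem ord_inv : v.ord φ⁻¹ = -v.ord φ := by
  rw [ord, map_inv₀, WithZero.log_inv, ord]

theorem ord_pow (n : ℕ) : v.ord (φ ^ n) = n * v.ord φ := by
  rw [ord, map_pow, WithZero.log_pow, ord]
  simp

theorem ord_neg : v.ord (-φ) = v.ord φ := by
  rw [ord, Valuation.map_neg, ord]

theorem ord_div (h : φ ≠ 0) (h' : ψ ≠ 0) : v.ord (φ / ψ) = v.ord φ - v.ord ψ := by
  rw [div_eq_mul_inv, ord_mul h (inv_ne_zero h'), ord_inv, sub_eq_add_neg]

/-- The case ψ = 0 is listed separately because `ord` is 0 there instead of infinite. -/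
theorem ord_add_eq_left (h : φ ≠ 0) (hlt : ψ = 0 ∨ v.ord φ < v.ord ψ) :
    v.ord (φ + ψ) = v.ord φ := by
  rcases hlt with rfl | hlt
  · rw [add_zero]
  · by_cases h' : ψ = 0
    · rw [h', add_zero]
    · rw [ord, ord, Valuation.map_add_eq_of_lt_left]
      rw [valuation_eq_exp_neg_ord h, valuation_eq_exp_neg_ord h', WithZero.exp_lt_exp]
      omega

theorem le_ord_add {n : ℤ} (h : φ + ψ ≠ 0) (h1 : φ = 0 ∨ n ≤ v.ord φ)
    (h2 : ψ = 0 ∨ n ≤ v.ord ψ) : n ≤ v.ord (φ + ψ) := by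
  have aux : ∀ χ : K, χ = 0 ∨ n ≤ v.ord χ → v.valuation K χ ≤ WithZero.exp (-n) := by
    rintro χ (rfl | hχ)
    · simp
    · by_cases h0 : χ = 0
      · simp [h0]
      · rw [valuation_eq_exp_neg_ord h0, WithZero.exp_le_exp]; omega
  have := (v.valuation K).map_add_le (aux φ h1) (aux ψ h2)
  rw [valuation_eq_exp_neg_ord h, WithZero.exp_le_exp] at this
  omega

theorem le_ord_algebraMap_iff {r : R} (hr : r ≠ 0) (n : ℕ) :
    (n : ℤ) ≤ v.ord (algebraMap R K r) ↔ r ∈ v.asIdeal ^ n := by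
  have h0 : algebraMap R K r ≠ 0 := by
    rwa [Ne, map_eq_zero_iff _ (IsFractionRing.injective R K)]
  rw [← v.intValuation_le_pow_iff_mem, ← v.valuation_of_algebraMap (K := K),
    valuation_eq_exp_neg_ord h0, WithZero.exp_le_exp, neg_le_neg_iff]

theorem ord_algebraMap_nonneg (r : R) : 0 ≤ v.ord (algebraMap R K r) := by
  by_cases hr : r = 0
  · simp [hr, ord]
  · exact (le_ord_algebraMap_iff hr 0).2 (by simp)

theorem ord_algebraMap_eq_iff {r : R} (hr : r ≠ 0) (n : ℕ) :
    v.ord (algebraMap R K r) = n ↔ r ∈ v.asIdeal ^ n ∧ r ∉ v.asIdeal ^ (n + 1) := by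
  rw [← le_ord_algebraMap_iff (K := K) hr, ← le_ord_algebraMap_iff (K := K) hr]
  push_cast
  omega

/-- Lying in exactly the i-th power of the prime means having order i, so additivity of the order
makes i - j independent of the chosen fraction. -/
theorem hasOrdAlong_iff (φ : K) (n : ℤ) :
    HyperellipticCurve.HasOrdAlong (algebraMap R K) v.asIdeal φ n ↔ φ ≠ 0 ∧ v.ord φ = n := by
  have hinj := IsFractionRing.injective R K
  constructor
  · rintro ⟨r, s, i, j, hr, hr', hs, hs', h, rfl⟩
    have hr0 : r ≠ 0 := by rintro rfl; exact hr' (zero_mem _)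
    have hs0 : s ≠ 0 := by rintro rfl; exact hs' (zero_mem _)
    have h0 : φ ≠ 0 := by
      rintro rfl
      rw [zero_mul] at h
      exact hr0 (hinj (h.symm.trans (map_zero _).symm))
    refine ⟨h0, ?_⟩
    have h1 := congrArg v.ord h
    rw [ord_mul h0 (by rwa [Ne, map_eq_zero_iff _ hinj]),
      (ord_algebraMap_eq_iff hr0 i).2 ⟨hr, hr'⟩, (ord_algebraMap_eq_iff hs0 j).2 ⟨hs, hs'⟩] at h1
    omega
  · rintro ⟨h0, rfl⟩
    obtain ⟨r, s, hs, rfl⟩ := IsFractionRing.div_surjective (A := R) φ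
    have hs0 := nonZeroDivisors.ne_zero hs
    have hr0 : r ≠ 0 := by rintro rfl; simp at h0
    have hs1 : algebraMap R K s ≠ 0 := by rwa [Ne, map_eq_zero_iff _ hinj]
    have hr1 : algebraMap R K r ≠ 0 := by rwa [Ne, map_eq_zero_iff _ hinj]
    obtain ⟨i, hi⟩ := Int.eq_ofNat_of_zero_le (ord_algebraMap_nonneg (K := K) (v := v) r)
    obtain ⟨j, hj⟩ := Int.eq_ofNat_of_zero_le (ord_algebraMap_nonneg (K := K) (v := v) s)
    obtain ⟨h1, h2⟩ := (ord_algebraMap_eq_iff hr0 i).1 hi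
    obtain ⟨h3, h4⟩ := (ord_algebraMap_eq_iff hs0 j).1 hj
    exact ⟨r, s, i, j, h1, h2, h3, h4, div_mul_cancel₀ _ hs1, by rw [ord_div hr1 hs1, hi, hj]⟩

theorem mem_range_of_ord_nonneg (h : ∀ v : HeightOneSpectrum R, 0 ≤ v.ord φ) :
    φ ∈ (algebraMap R K).range := by
  refine mem_integers_of_valuation_le_one K φ fun v => ?_
  by_cases h0 : φ = 0
  · simp [h0]
  · rw [valuation_eq_exp_neg_ord h0, ← WithZero.exp_zero, WithZero.exp_le_exp]
    have := h v
    omega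

end IsDedekindDomain.HeightOneSpectrum

/-! ### Orders of functions on a double cover -/

namespace DoubleCover

open IsDedekindDomain HeightOneSpectrum

variable {k : Type*} [Field k] {F : k[X]} {a b : k} [IsDedekindDomain (Ring F)]
  {K : Type*} [Field K] [Algebra (Ring F) K] [IsFractionRing (Ring F) K]

theorem ord_eq_zero (h : b ^ 2 = F.eval a) {z : Ring F} (hz : evalAt h z ≠ 0) :
    (prime h).ord (algebraMap (Ring F) K z) = 0 :=
  ord_eq_of_valuation (by rw [valuation_of_algebraMap, intValuation_eq_one h hz]; rfl)

theorem ord_X_sub_of_ne_zero (h2 : (2 : k) ≠ 0) (h : b ^ 2 = F.eval a) (hb : b ≠ 0) :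
    (prime h).ord (algebraMap (Ring F) K (ofX F (X - C a))) = 1 :=
  ord_eq_of_valuation (by rw [valuation_of_algebraMap, intValuation_X_sub_of_ne_zero h2 h hb])

theorem ord_X_sub_of_eq_zero (hF : NoDoubleRoot F) (h : (0 : k) ^ 2 = F.eval a) :
    (prime h).ord (algebraMap (Ring F) K (ofX F (X - C a))) = 2 :=
  ord_eq_of_valuation (by rw [valuation_of_algebraMap, intValuation_X_sub_of_eq_zero hF h])

theorem ord_y (hF : NoDoubleRoot F) (h : (0 : k) ^ 2 = F.eval a) :
    (prime h).ord (algebraMap (Ring F) K (y F)) = 1 :=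
  ord_eq_of_valuation (by rw [valuation_of_algebraMap, intValuation_y hF h])

theorem ord_conj (h : b ^ 2 = F.eval a) (h' : (-b) ^ 2 = F.eval a) (z : Ring F) :
    (prime h').ord (algebraMap (Ring F) K (conj F z))
      = (prime h).ord (algebraMap (Ring F) K z) := by
  by_cases hz : z = 0
  · simp [hz, ord]
  have hz' : conj F z ≠ 0 := by simpa using hz
  obtain ⟨n, hn⟩ := Int.eq_ofNat_of_zero_le
    (ord_algebraMap_nonneg (K := K) (v := prime h) z)
  rw [hn, ord_algebraMap_eq_iff hz', mem_pow_iff_conj h, mem_pow_iff_conj h,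
    ← ord_algebraMap_eq_iff (K := K) hz, hn]

/-- The ramification index of the double cover at a point with ordinate `b`. -/
def ramification (b : k) : ℕ := by classical exact if b = 0 then 2 else 1

theorem ord_X_sub (h2 : (2 : k) ≠ 0) (hF : NoDoubleRoot F) (h : b ^ 2 = F.eval a) :
    (prime h).ord (algebraMap (Ring F) K (ofX F (X - C a))) = ramification b := by
  by_cases hb : b = 0
  · subst hb
    rw [ord_X_sub_of_eq_zero hF h]
    simp [ramification]
  · rw [ord_X_sub_of_ne_zero h2 h hb]
    simp [ramification, hb]

theorem ord_ofX (h2 : (2 : k) ≠ 0) (hF : NoDoubleRoot F) (h : b ^ 2 = F.eval a) {r : k[X]}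
    (hr : r ≠ 0) : (prime h).ord (algebraMap (Ring F) K (ofX F r))
      = ramification b * r.rootMultiplicity a := by
  obtain ⟨s, hs, hs'⟩ := exists_eq_pow_rootMultiplicity_mul_and_not_dvd r hr a
  have hsa : s.eval a ≠ 0 := fun h => hs' (dvd_iff_isRoot.2 h)
  have hinj := (IsFractionRing.injective (Ring F) K).comp (ofX_injective F)
  have h0 : ∀ t : k[X], t ≠ 0 → algebraMap (Ring F) K (ofX F t) ≠ 0 := fun t ht h =>
    ht (hinj (h.trans (by simp)))
  have hs0 : s ≠ 0 := by rintro rfl; simp at hsa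
  conv_lhs => rw [hs]
  rw [map_mul, map_mul, map_pow, map_pow,
    ord_mul (pow_ne_zero _ (h0 _ (X_sub_C_ne_zero a))) (h0 _ hs0), ord_pow, ord_X_sub h2 hF h,
    ord_eq_zero h (by simpa using hsa)]
  ring

end DoubleCover

/-! ### Smoothness of the two charts -/

namespace HyperellipticCurve

open DoubleCover IsDedekindDomain

variable {k : Type*} [Field k] {g : ℕ} (C : HyperellipticCurve k g)

theorem f_ne_zero : C.f ≠ 0 := C.monic.ne_zero

/-- Up to sign the discriminant is the resultant of f and f'. Splitting x - a off f makes f'(a) a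
factor of that resultant, and f'(a) = 0 at a double root. -/
theorem noDoubleRoot_f : NoDoubleRoot C.f := by
  rintro a ⟨q, hq⟩
  apply C.discr_ne_zero
  have hpos : 0 < C.f.degree := by
    rw [← natDegree_pos_iff_degree_pos, C.natDegree_eq]; omega
  have h1 := resultant_deriv hpos
  set s := (X - Polynomial.C a) * q with hs
  have hf : C.f = (X - Polynomial.C a) * s := by rw [hq, hs]; ring
  have hs0 : s ≠ 0 := by
    intro h; rw [h, mul_zero] at hf; exact C.f_ne_zero hf
  have h2 : C.f.natDegree = (X - Polynomial.C a).natDegree + s.natDegree := by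
    rw [← natDegree_mul (X_sub_C_ne_zero a) hs0, ← hf]
  have h3 : resultant C.f (derivative C.f) C.f.natDegree (C.f.natDegree - 1) = 0 := by
    have h4 := resultant_mul_left (X - Polynomial.C a) s (derivative C.f) (C.f.natDegree - 1)
      (natDegree_derivative_le _)
    rw [← h2, ← hf, natDegree_X_sub_C, resultant_X_sub_C_left _ _ _ (natDegree_derivative_le _)]
      at h4
    rw [h4]
    have h5 : (derivative C.f).eval a = 0 := by
      rw [hf, hs]; simp
    rw [h5, zero_mul]
  rw [h3, C.monic.leadingCoeff, mul_one] at h1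
  exact (mul_eq_zero.1 h1.symm).resolve_left (pow_ne_zero _ (by simp))

theorem coeff_zero_reflect : (C.f.reflect (2 * g + 1)).coeff 0 = 1 := by
  rw [coeff_reflect, revAt_le (Nat.zero_le _), Nat.sub_zero, ← C.natDegree_eq]
  exact C.monic

/-- The root t = 0 is simple because f is monic. A double root a ≠ 0 of h would be one of the
reversal of f, and reversing back would give f the double root 1/a. -/
theorem noDoubleRoot_h : NoDoubleRoot C.h := by
  intro a ha
  by_cases ha0 : a = 0
  · subst ha0
    rw [C_0, sub_zero, h, sq] at ha
    have h1 := (X_dvd_iff).1 ((mul_dvd_mul_iff_left X_ne_zero).1 ha)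
    rw [C.coeff_zero_reflect] at h1
    exact one_ne_zero h1
  · have hcop : IsCoprime ((X - Polynomial.C a) ^ 2) (X : k[X]) := by
      refine IsCoprime.pow_left ?_
      have := isCoprime_X_sub_C_of_isUnit_sub (R := k) (a := a) (b := 0)
        (by simpa using ha0)
      simpa using this
    obtain ⟨q, hq⟩ := hcop.dvd_of_dvd_mul_left ha
    have hr0 : C.f.reflect (2 * g + 1) ≠ 0 := by
      intro h0; have := C.coeff_zero_reflect; rw [h0] at this; simp at this
    have hq0 : q ≠ 0 := by rintro rfl; exact hr0 (by rw [hq, mul_zero])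
    have hd : (C.f.reflect (2 * g + 1)).natDegree ≤ 2 * g + 1 := by
      refine natDegree_le_iff_coeff_eq_zero.2 fun i hi => ?_
      rw [coeff_reflect, revAt_eq_self_of_lt hi]
      exact coeff_eq_zero_of_natDegree_lt (by rw [C.natDegree_eq]; exact hi)
    have hd1 : ((X - Polynomial.C a) ^ 2).natDegree = 2 := by
      rw [natDegree_pow, natDegree_X_sub_C]
    rw [hq, natDegree_mul (pow_ne_zero _ (X_sub_C_ne_zero a)) hq0, hd1] at hd
    obtain ⟨m, hm⟩ : ∃ m, 2 * g + 1 = (1 + 1) + m := ⟨2 * g + 1 - 2, by omega⟩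
    have h1 : C.f = reflect (2 * g + 1) (C.f.reflect (2 * g + 1)) := by
      ext i; simp
    have h2 : reflect 1 (X - Polynomial.C a) = -Polynomial.C a * (X - Polynomial.C a⁻¹) := by
      have h3 : -Polynomial.C a * (X - Polynomial.C a⁻¹) = 1 - Polynomial.C a * X := by
        rw [mul_sub, neg_mul, neg_mul, ← C_mul, mul_inv_cancel₀ ha0, C_1]; ring
      rw [h3, reflect_sub, reflect_C, pow_one, ← pow_one (X : k[X]), reflect_monomial]
      simp
    rw [hq, sq, hm, reflect_mul _ _ (by rw [← sq, hd1]) (by omega),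
      reflect_mul _ _ (natDegree_X_sub_C_le a) (natDegree_X_sub_C_le a), h2] at h1
    refine C.noDoubleRoot_f a⁻¹ ⟨Polynomial.C a * Polynomial.C a * reflect m q, ?_⟩
    rw [h1]; ring

theorem irreducible_equation_inf : Irreducible (X ^ 2 - Polynomial.C C.h : k[X][X]) := by
  have hm : (X ^ 2 - Polynomial.C C.h : k[X][X]).Monic := monic_X_pow_sub_C _ (by norm_num)
  have hd : (X ^ 2 - Polynomial.C C.h : k[X][X]).natDegree = 2 := natDegree_X_pow_sub_C
  rw [hm.irreducible_iff_roots_eq_zero_of_degree_le_three (by omega) (by omega),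
    Multiset.eq_zero_iff_forall_notMem]
  intro a ha
  have h1 : a ^ 2 = C.h := by
    have := (mem_roots'.1 ha).2
    simpa [IsRoot, sub_eq_zero] using this
  -- A square root of h is divisible by t because h is, and so t^2 would divide h.
  have h2 : (X : k[X]) ∣ a := prime_X.dvd_of_dvd_pow (n := 2) (by rw [h1]; exact ⟨_, rfl⟩)
  refine C.noDoubleRoot_h 0 ?_
  rw [C_0, sub_zero, ← h1]
  exact pow_dvd_pow_of_dvd h2 2

instance : IsDomain C.CoordRingInf :=
  AdjoinRoot.isDomain_of_prime C.irreducible_equation_inf.prime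

theorem isDedekindDomain_coordRing [IsAlgClosed k] (h2 : (2 : k) ≠ 0) :
    IsDedekindDomain C.CoordRing :=
  DoubleCover.isDedekindDomain h2 C.noDoubleRoot_f

theorem isDedekindDomain_coordRingInf [IsAlgClosed k] (h2 : (2 : k) ≠ 0) :
    IsDedekindDomain C.CoordRingInf :=
  DoubleCover.isDedekindDomain h2 C.noDoubleRoot_h

/-! ### The function field as fraction field of the chart at infinity -/

instance : Algebra C.CoordRingInf C.FunctionField := C.infToFunctionField.toAlgebra

theorem algebraMap_inf_ofX (r : k[X]) :
    algebraMap C.CoordRingInf C.FunctionField (ofX C.h r)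
      = eval₂ (C.ofPoly.comp Polynomial.C) C.x⁻¹ r :=
  AdjoinRoot.lift_of C.gluing_relation

theorem algebraMap_inf_X :
    algebraMap C.CoordRingInf C.FunctionField (ofX C.h X) = C.x⁻¹ := by
  rw [algebraMap_inf_ofX, eval₂_X]

theorem algebraMap_inf_C (c : k) :
    algebraMap C.CoordRingInf C.FunctionField (ofX C.h (Polynomial.C c))
      = C.ofPoly (Polynomial.C c) := by
  rw [algebraMap_inf_ofX, eval₂_C]; rfl

theorem algebraMap_inf_y :
    algebraMap C.CoordRingInf C.FunctionField (DoubleCover.y C.h) = C.y / C.x ^ (g + 1) :=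
  AdjoinRoot.lift_root C.gluing_relation

theorem eval₂_x (r : k[X]) : eval₂ (C.ofPoly.comp Polynomial.C) C.x r = C.ofPoly r := by
  have := hom_eval₂ r Polynomial.C C.ofPoly X
  rw [eval₂_C_X] at this
  exact this.symm

theorem algebraMap_inf_injective :
    Function.Injective (algebraMap C.CoordRingInf C.FunctionField) := by
  rw [injective_iff_map_eq_zero]
  intro z hz
  obtain ⟨r, w, rfl⟩ := exists_eq_add_mul_y C.h z
  by_contra h0
  have hN : algebraMap C.CoordRingInf C.FunctionField (ofX C.h (r ^ 2 - C.h * w ^ 2)) = 0 := by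
    rw [← mul_conj, map_mul, hz, zero_mul]
  -- The norm is a polynomial in t = 1/x. Multiplying by a power of x turns its vanishing into that
  -- of a polynomial in x, where injectivity is known.
  have hN0 : r ^ 2 - C.h * w ^ 2 = 0 := by
    rw [algebraMap_inf_ofX] at hN
    generalize r ^ 2 - C.h * w ^ 2 = N at hN
    let _ : Invertible C.x := invertibleOfNonzero C.x_ne_zero
    rw [← invOf_eq_inv] at hN
    have h1 := eval₂_reflect_mul_pow (C.ofPoly.comp Polynomial.C) C.x N.natDegree
      (reflect N.natDegree N) (by
        refine natDegree_le_iff_coeff_eq_zero.2 fun i hi => ?_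
        rw [coeff_reflect, revAt_eq_self_of_lt hi]
        exact coeff_eq_zero_of_natDegree_lt hi)
    have h2 : reflect N.natDegree (reflect N.natDegree N) = N := by
      ext i; simp
    rw [h2, hN, zero_mul, eval₂_x, eq_comm, map_eq_zero_iff _ C.ofPoly_injective] at h1
    rw [← h2, h1, reflect_zero]
  have h1 := mul_conj C.h r w
  rw [hN0, map_zero] at h1
  have h2 := (mul_eq_zero.1 h1).resolve_left h0
  have h3 := congrArg (conj C.h) h2
  apply h0
  simpa using h3

instance : IsFractionRing C.CoordRingInf C.FunctionField := by
  have : FaithfulSMul C.CoordRingInf C.FunctionField :=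
    (faithfulSMul_iff_algebraMap_injective _ _).2 C.algebraMap_inf_injective
  -- The image of this embedding contains x = 1/t and y = s x^{g+1}, hence the whole function field.
  let j : FractionRing C.CoordRingInf →+* C.FunctionField :=
    IsFractionRing.lift C.algebraMap_inf_injective
  have hj : ∀ z, algebraMap C.CoordRingInf C.FunctionField z ∈ j.fieldRange := fun z =>
    ⟨algebraMap _ _ z, IsFractionRing.lift_algebraMap _ _⟩
  have hx : C.x ∈ j.fieldRange := by
    have := hj (ofX C.h X)
    rw [algebraMap_inf_X] at this
    simpa using inv_mem this
  have hpoly : ∀ r, C.ofPoly r ∈ j.fieldRange := by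
    intro r
    rw [← C.eval₂_x, eval₂_eq_sum]
    refine sum_mem fun n _ => mul_mem ?_ (pow_mem hx n)
    have := hj (ofX C.h (Polynomial.C (r.coeff n)))
    rwa [algebraMap_inf_C] at this
  have hy : C.y ∈ j.fieldRange := by
    have := mul_mem (hj (DoubleCover.y C.h)) (pow_mem hx (g + 1))
    rwa [algebraMap_inf_y, div_mul_cancel₀ _ (pow_ne_zero _ C.x_ne_zero)] at this
  have hR : ∀ z, algebraMap C.CoordRing C.FunctionField z ∈ j.fieldRange := by
    intro z
    obtain ⟨r, w, rfl⟩ := exists_eq_add_mul_y C.f z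
    rw [map_add, map_mul]
    exact add_mem (hpoly r) (mul_mem (hpoly w) hy)
  refine IsFractionRing.of_field _ _ fun z => ?_
  obtain ⟨r, s, -, rfl⟩ := IsFractionRing.div_surjective (A := C.CoordRing) z
  obtain ⟨z', hz'⟩ := div_mem (hR r) (hR s)
  obtain ⟨r', s', -, rfl⟩ := IsFractionRing.div_surjective (A := C.CoordRingInf) z'
  refine ⟨r', s', ?_⟩
  rw [← hz', map_div₀]
  simp [j, IsFractionRing.lift_algebraMap]

end HyperellipticCurve

namespace HyperellipticCurve

open DoubleCover IsDedekindDomain HeightOneSpectrum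

variable {k : Type*} [Field k] {g : ℕ} (C : HyperellipticCurve k g)

/-! ### Orders at the points of the curve -/

theorem origin_equation : (0 : k) ^ 2 = C.h.eval 0 := by simp [h]

theorem asIdeal_prime_origin : (prime C.origin_equation).asIdeal = C.maxIdealInf := by
  change Ideal.span _ = _
  simp [maxIdealInf]

variable {C}

theorem ofPoly_ne_zero {r : k[X]} (hr : r ≠ 0) : C.ofPoly r ≠ 0 := by
  rwa [Ne, map_eq_zero_iff _ C.ofPoly_injective]

theorem y_ne_zero : C.y ≠ 0 := by
  intro h0
  have := C.y_sq
  rw [h0, zero_pow two_ne_zero] at this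
  exact ofPoly_ne_zero C.f_ne_zero this.symm

/-- The function `p - q y`. -/
def linear (C : HyperellipticCurve k g) (p q : k[X]) : C.FunctionField :=
  C.ofPoly p - C.ofPoly q * C.y

/-- The norm of `p - q y`. -/
def norm (C : HyperellipticCurve k g) (p q : k[X]) : k[X] := p ^ 2 - C.f * q ^ 2

theorem linear_mul_linear_neg (p q : k[X]) :
    C.linear p q * C.linear p (-q) = C.ofPoly (C.norm p q) := by
  have := C.y_sq
  simp only [linear, norm, map_sub, map_mul, map_pow, map_neg, ← this]
  ring

theorem linear_eq_algebraMap (p q : k[X]) : C.linear p q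
    = algebraMap C.CoordRing C.FunctionField (ofX C.f p - ofX C.f q * DoubleCover.y C.f) := by
  rw [map_sub, map_mul]; rfl

theorem natDegree_f_mul_sq {q : k[X]} (hq : q ≠ 0) :
    (C.f * q ^ 2).natDegree = 2 * g + 1 + 2 * q.natDegree := by
  rw [natDegree_mul C.f_ne_zero (pow_ne_zero 2 hq), C.natDegree_eq, natDegree_pow]

/-- The degree of p^2 is even and that of f q^2 is odd, so the leading terms cannot cancel. -/
theorem natDegree_norm_eq_max {p q : k[X]} (hq : q ≠ 0) :
    (C.norm p q).natDegree = max (2 * p.natDegree) (2 * g + 1 + 2 * q.natDegree) := by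
  have h1 := natDegree_f_mul_sq (C := C) hq
  have h2 : (p ^ 2).natDegree = 2 * p.natDegree := natDegree_pow _ _
  rw [norm]
  rcases lt_or_gt_of_ne (show 2 * p.natDegree ≠ 2 * g + 1 + 2 * q.natDegree by omega) with h | h
  · rw [natDegree_sub_eq_right_of_natDegree_lt (by omega), h1, max_eq_right h.le]
  · rw [natDegree_sub_eq_left_of_natDegree_lt (by omega), h2, max_eq_left h.le]

theorem norm_ne_zero {p q : k[X]} (h : p ≠ 0 ∨ q ≠ 0) : C.norm p q ≠ 0 := by
  by_cases hp : p = 0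
  · have hq := h.resolve_left (not_not.2 hp)
    simp [norm, hp, C.f_ne_zero, hq]
  · by_cases hq : q = 0
    · simp [norm, hp, hq]
    · intro h0
      have := natDegree_norm_eq_max (C := C) (p := p) hq
      rw [h0, natDegree_zero] at this
      omega

theorem linear_ne_zero {p q : k[X]} (h : C.norm p q ≠ 0) : C.linear p q ≠ 0 :=
  left_ne_zero_of_mul (b := C.linear p (-q)) (by
    rw [linear_mul_linear_neg]; exact ofPoly_ne_zero h)

variable (C)

section Order

variable [IsDedekindDomain C.CoordRing] [IsDedekindDomain C.CoordRingInf]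

/-- The order of a nonzero rational function at a point of the curve. -/
def ordAt : C.Point → C.FunctionField → ℤ
  | .affine P => (prime P.equation).ord
  | .infinity => (prime C.origin_equation).ord

theorem hasOrd_iff (P : C.Point) (φ : C.FunctionField) (n : ℤ) :
    C.HasOrd P φ n ↔ φ ≠ 0 ∧ C.ordAt P φ = n := by
  cases P with
  | affine P => exact hasOrdAlong_iff (v := prime P.equation) φ n
  | infinity =>
    rw [ordAt, ← hasOrdAlong_iff, asIdeal_prime_origin]
    rfl

variable {C}

theorem ordAt_mul (P : C.Point) {φ ψ : C.FunctionField} (h : φ ≠ 0) (h' : ψ ≠ 0) :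
    C.ordAt P (φ * ψ) = C.ordAt P φ + C.ordAt P ψ := by
  cases P <;> exact ord_mul h h'

theorem ordAt_inv (P : C.Point) (φ : C.FunctionField) : C.ordAt P φ⁻¹ = -C.ordAt P φ := by
  cases P <;> exact ord_inv

theorem ordAt_one (P : C.Point) : C.ordAt P 1 = 0 := by
  cases P <;> exact ord_one

theorem ordAt_neg (P : C.Point) (φ : C.FunctionField) : C.ordAt P (-φ) = C.ordAt P φ := by
  cases P <;> exact ord_neg

theorem ordAt_pow (P : C.Point) (φ : C.FunctionField) (n : ℕ) :
    C.ordAt P (φ ^ n) = n * C.ordAt P φ := by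
  cases P <;> exact ord_pow n

theorem ordAt_add_eq_left (P : C.Point) {φ ψ : C.FunctionField} (h : φ ≠ 0)
    (hlt : ψ = 0 ∨ C.ordAt P φ < C.ordAt P ψ) : C.ordAt P (φ + ψ) = C.ordAt P φ := by
  cases P <;> exact ord_add_eq_left h hlt

theorem le_ordAt_add (P : C.Point) {φ ψ : C.FunctionField} {n : ℤ} (h : φ + ψ ≠ 0)
    (h1 : φ = 0 ∨ n ≤ C.ordAt P φ) (h2 : ψ = 0 ∨ n ≤ C.ordAt P ψ) : n ≤ C.ordAt P (φ + ψ) := by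
  cases P <;> exact le_ord_add h h1 h2

/-! ### Orders at infinity -/

theorem ordAt_infinity_x : C.ordAt .infinity C.x = -2 := by
  have h1 := ord_X_sub_of_eq_zero (K := C.FunctionField) C.noDoubleRoot_h C.origin_equation
  rw [C_0, sub_zero, algebraMap_inf_X, ord_inv] at h1
  change (prime C.origin_equation).ord C.x = -2
  omega

/-- At ∞ the function s = y / x^{g+1} is a uniformizer and x has order -2. -/
theorem ordAt_infinity_y : C.ordAt .infinity C.y = -(2 * g + 1) := by
  have h1 : C.ordAt .infinity (C.y / C.x ^ (g + 1)) = 1 := by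
    rw [← algebraMap_inf_y]
    exact ord_y C.noDoubleRoot_h C.origin_equation
  have hx := pow_ne_zero (g + 1) C.x_ne_zero
  rw [div_eq_mul_inv, ordAt_mul _ y_ne_zero (inv_ne_zero hx), ordAt_inv, ordAt_pow,
    ordAt_infinity_x] at h1
  push_cast at h1
  omega

theorem ordAt_infinity_const {c : k} (hc : c ≠ 0) :
    C.ordAt .infinity (C.ofPoly (Polynomial.C c)) = 0 := by
  rw [← algebraMap_inf_C]
  exact ord_eq_zero _ (by simpa using hc)

theorem ordAt_infinity_ofPoly {r : k[X]} (hr : r ≠ 0) :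
    C.ordAt .infinity (C.ofPoly r) = -(2 * r.natDegree) := by
  induction hn : r.natDegree generalizing r with
  | zero =>
    rw [eq_C_of_natDegree_eq_zero hn] at hr ⊢
    rw [ordAt_infinity_const (by simpa using hr)]
    simp
  | succ n ih =>
    have hd : r.divX.natDegree = n := by rw [natDegree_divX_eq_natDegree_tsub_one]; omega
    have hd0 : r.divX ≠ 0 := by
      intro h0
      have := divX_mul_X_add r
      rw [h0, zero_mul, zero_add] at this
      rw [← this, natDegree_C] at hn
      omega
    have h1 : C.ofPoly r = C.ofPoly r.divX * C.x + C.ofPoly (Polynomial.C (r.coeff 0)) := by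
      rw [x, ← map_mul, ← map_add, divX_mul_X_add]
    have h2 : C.ordAt .infinity (C.ofPoly r.divX * C.x) = -(2 * (n + 1 : ℕ)) := by
      rw [ordAt_mul _ (ofPoly_ne_zero hd0) C.x_ne_zero, ih hd0 hd, ordAt_infinity_x]
      push_cast; ring
    rw [h1, ordAt_add_eq_left _ (mul_ne_zero (ofPoly_ne_zero hd0) C.x_ne_zero), h2]
    by_cases hc : r.coeff 0 = 0
    · left; simp [hc]
    · right; rw [h2, ordAt_infinity_const hc]; push_cast; omega

/-- The orders of p and qy at ∞ have different parities, so the smaller one is the order of the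
difference; it matches the dominant term of the norm. -/
theorem ordAt_infinity_linear {p q : k[X]} (h : C.norm p q ≠ 0) :
    C.ordAt .infinity (C.linear p q) = -(C.norm p q).natDegree := by
  have hy : ∀ q : k[X], q ≠ 0 →
      C.ordAt .infinity (-(C.ofPoly q * C.y)) = -(2 * g + 1 + 2 * q.natDegree) := by
    intro q hq
    rw [ordAt_neg, ordAt_mul _ (ofPoly_ne_zero hq) y_ne_zero, ordAt_infinity_ofPoly hq,
      ordAt_infinity_y]
    ring
  by_cases hp : p = 0
  · subst hp
    have hq : q ≠ 0 := by rintro rfl; simp [norm] at h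
    have h1 : C.linear 0 q = -(C.ofPoly q * C.y) := by simp [linear]
    have h2 : C.norm 0 q = -(C.f * q ^ 2) := by simp [norm]
    rw [h1, hy q hq, h2, natDegree_neg, natDegree_f_mul_sq hq]
    push_cast; ring
  · by_cases hq : q = 0
    · subst hq
      have h1 : C.linear p 0 = C.ofPoly p := by simp [linear]
      have h2 : C.norm p 0 = p ^ 2 := by simp [norm]
      rw [h1, h2, ordAt_infinity_ofPoly hp, natDegree_pow]
      push_cast; ring
    · have h1 := ordAt_infinity_ofPoly (C := C) hp
      have h2 := hy q hq
      have hp' := ofPoly_ne_zero (C := C) hp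
      have hq' : -(C.ofPoly q * C.y) ≠ 0 :=
        neg_ne_zero.2 (mul_ne_zero (ofPoly_ne_zero hq) y_ne_zero)
      rw [natDegree_norm_eq_max hq, linear, sub_eq_add_neg]
      rcases lt_or_gt_of_ne (show 2 * p.natDegree ≠ 2 * g + 1 + 2 * q.natDegree by omega)
        with h | h
      · rw [max_eq_right h.le, add_comm, ordAt_add_eq_left _ hq' (Or.inr (by omega)), h2]
        push_cast; ring
      · rw [max_eq_left h.le, ordAt_add_eq_left _ hp' (Or.inr (by omega)), h1]
        push_cast; ring

/-! ### Orders at affine points -/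

theorem ordAt_affine_ofPoly (h2 : (2 : k) ≠ 0) (P : C.AffinePoint) {r : k[X]} (hr : r ≠ 0) :
    C.ordAt (.affine P) (C.ofPoly r) = ramification P.y * r.rootMultiplicity P.x :=
  ord_ofX h2 C.noDoubleRoot_f P.equation hr

theorem ordAt_affine_linear_nonneg (P : C.AffinePoint) (p q : k[X]) :
    0 ≤ C.ordAt (.affine P) (C.linear p q) := by
  rw [linear_eq_algebraMap]
  exact ord_algebraMap_nonneg _

theorem ordAt_conj_linear (P : C.AffinePoint) (p q : k[X]) :
    C.ordAt (.affine P.conj) (C.linear p q) = C.ordAt (.affine P) (C.linear p (-q)) := by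
  have h1 := ord_conj (K := C.FunctionField) P.equation P.conj.equation
    (ofX C.f p - ofX C.f (-q) * DoubleCover.y C.f)
  rw [← linear_eq_algebraMap] at h1
  refine Eq.trans ?_ h1
  rw [linear_eq_algebraMap]
  simp [ordAt]
  rfl

theorem ordAt_linear_add_conj (h2 : (2 : k) ≠ 0) (P : C.AffinePoint) {p q : k[X]}
    (h : C.norm p q ≠ 0) :
    C.ordAt (.affine P) (C.linear p q) + C.ordAt (.affine P.conj) (C.linear p q)
      = ramification P.y * (C.norm p q).rootMultiplicity P.x := by
  have h' : C.norm p (-q) ≠ 0 := by simpa [norm] using h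
  rw [ordAt_conj_linear, ← ordAt_mul _ (linear_ne_zero h) (linear_ne_zero h'),
    linear_mul_linear_neg, ordAt_affine_ofPoly h2 P h]

end Order

end HyperellipticCurve

namespace HyperellipticCurve

open DoubleCover IsDedekindDomain

variable {k : Type*} [Field k] {g : ℕ} {C : HyperellipticCurve k g}

/-! ### Multisets of affine points -/

@[simp] theorem AffinePoint.conj_x (P : C.AffinePoint) : P.conj.x = P.x := rfl

@[simp] theorem AffinePoint.conj_y (P : C.AffinePoint) : P.conj.y = -P.y := rfl

theorem AffinePoint.conj_conj (P : C.AffinePoint) : P.conj.conj = P := by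
  ext <;> simp [AffinePoint.conj]

theorem AffinePoint.conj_injective :
    Function.Injective (AffinePoint.conj : C.AffinePoint → C.AffinePoint) :=
  Function.LeftInverse.injective AffinePoint.conj_conj

theorem AffinePoint.eq_or_eq_conj {P Q : C.AffinePoint} (h : P.x = Q.x) :
    P = Q ∨ P = Q.conj := by
  have h1 : P.y ^ 2 = Q.y ^ 2 := by rw [P.equation, Q.equation, h]
  rcases sq_eq_sq_iff_eq_or_eq_neg.1 h1 with h2 | h2
  · exact Or.inl (AffinePoint.ext h h2)
  · exact Or.inr (AffinePoint.ext h h2)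

theorem AffinePoint.conj_eq_self_iff (h2 : (2 : k) ≠ 0) (P : C.AffinePoint) :
    P.conj = P ↔ P.y = 0 := by
  constructor
  · intro h
    have h1 : -P.y = P.y := congrArg AffinePoint.y h
    have h3 : 2 * P.y = 0 := by linear_combination -h1
    exact (mul_eq_zero.1 h3).resolve_left h2
  · intro h
    exact AffinePoint.ext rfl (by simp [AffinePoint.conj, h])

theorem exists_affinePoint [IsAlgClosed k] (C : HyperellipticCurve k g) (a : k) :
    ∃ P : C.AffinePoint, P.x = a := by
  obtain ⟨b, hb⟩ := IsAlgClosed.exists_pow_nat_eq (C.f.eval a) (n := 2) (by norm_num)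
  exact ⟨⟨a, b, hb⟩, rfl⟩

/-- The effective divisor of a multiset of affine points. -/
def effective (R : Multiset C.AffinePoint) : C.Divisor :=
  (R.map fun P => Finsupp.single (Point.affine P) (1 : ℤ)).sum

theorem effective_add (R S : Multiset C.AffinePoint) :
    effective (R + S) = effective R + effective S := by
  simp [effective]

theorem effective_cons (P : C.AffinePoint) (R : Multiset C.AffinePoint) :
    effective (P ::ₘ R) = Finsupp.single (Point.affine P) 1 + effective R := by
  simp [effective]

open Classical in
theorem effective_affine (R : Multiset C.AffinePoint) (P : C.AffinePoint) :
    effective R (.affine P) = R.count P := by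
  induction R using Multiset.induction with
  | empty => simp [effective]
  | cons Q R ih =>
    rw [effective_cons, Finsupp.add_apply, ih, Multiset.count_cons, Finsupp.single_apply]
    by_cases h : P = Q
    · simp [h, add_comm]
    · simp [h, Point.affine.injEq, eq_comm]

theorem effective_infinity (R : Multiset C.AffinePoint) : effective R .infinity = 0 := by
  induction R using Multiset.induction with
  | empty => simp [effective]
  | cons Q R ih => simp [effective_cons, ih]

/-- The multiset of values of a finite family of points. -/
abbrev points (P : Fin g → C.AffinePoint) : Multiset C.AffinePoint := Finset.univ.val.map P

theorem sumDivisor_eq_effective (P : Fin g → C.AffinePoint) :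
    C.sumDivisor P = effective (points P) := by
  rw [sumDivisor, effective, points, Multiset.map_map]; rfl

theorem exists_fin_map_eq {α : Type*} {n : ℕ} {R : Multiset α} (h : R.card = n) :
    ∃ Q : Fin n → α, Finset.univ.val.map Q = R := by
  subst h
  induction R using Quotient.inductionOn with
  | h l => exact ⟨l.get, (Fin.univ_val_map _).trans (congrArg _ (List.ofFn_get l))⟩

theorem prod_X_sub_eq (P : Fin g → C.AffinePoint) :
    ∏ i, (X - Polynomial.C (P i).x) = ((points P).map fun P => X - Polynomial.C P.x).prod := by
  rw [points, Multiset.map_map]; rfl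

/-! ### Principal divisors -/

theorem jacClass_add_eq_iff (P P' Q : Fin g → C.AffinePoint) :
    C.jacClass P + C.jacClass P' = C.jacClass Q ↔
      effective (points P) + effective (points P') - effective (points Q)
        - Finsupp.single Point.infinity (g : ℤ) ∈ C.principalDivisors := by
  rw [jacClass, jacClass, jacClass, ← QuotientAddGroup.mk_add, QuotientAddGroup.eq,
    AddSubgroup.mem_addSubgroupOf, ← neg_mem_iff]
  simp only [sumDivisor_eq_effective, AddSubgroup.coe_add, AddSubgroup.coe_neg,
    AddMemClass.mk_add_mk]
  congr! 1
  abel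

theorem jacClass_eq_iff (P Q : Fin g → C.AffinePoint) :
    C.jacClass P = C.jacClass Q ↔
      effective (points P) - effective (points Q) ∈ C.principalDivisors := by
  rw [jacClass, jacClass, QuotientAddGroup.eq, AddSubgroup.mem_addSubgroupOf, ← neg_mem_iff]
  simp only [sumDivisor_eq_effective, AddSubgroup.coe_add, AddSubgroup.coe_neg]
  congr! 1
  abel

section Principal

variable [IsDedekindDomain C.CoordRing] [IsDedekindDomain C.CoordRingInf]

theorem isDivOfFunction_iff {E : C.Divisor} :
    C.IsDivOfFunction E ↔ ∃ φ : C.FunctionField, φ ≠ 0 ∧ ∀ P, C.ordAt P φ = E P := by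
  constructor
  · rintro ⟨φ, h, h'⟩
    exact ⟨φ, h, fun P => ((C.hasOrd_iff _ _ _).1 (h' P)).2⟩
  · rintro ⟨φ, h, h'⟩
    exact ⟨φ, h, fun P => (C.hasOrd_iff _ _ _).2 ⟨h, h' P⟩⟩

/-- Divisors of functions already form a group, so taking the closure adds nothing. -/
theorem mem_principalDivisors_iff {E : C.Divisor} :
    E ∈ C.principalDivisors ↔ C.IsDivOfFunction E := by
  refine ⟨fun h => ?_, fun h => AddSubgroup.subset_closure h⟩
  induction h using AddSubgroup.closure_induction with
  | mem E h => exact h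
  | zero => exact isDivOfFunction_iff.2 ⟨1, one_ne_zero, fun P => ordAt_one P⟩
  | add E E' _ _ h h' =>
    obtain ⟨φ, h0, h1⟩ := isDivOfFunction_iff.1 h
    obtain ⟨ψ, h0', h1'⟩ := isDivOfFunction_iff.1 h'
    exact isDivOfFunction_iff.2 ⟨φ * ψ, mul_ne_zero h0 h0', fun P => by
      rw [ordAt_mul _ h0 h0', h1, h1']; rfl⟩
  | neg E _ h =>
    obtain ⟨φ, h0, h1⟩ := isDivOfFunction_iff.1 h
    exact isDivOfFunction_iff.2 ⟨φ⁻¹, inv_ne_zero h0, fun P => by rw [ordAt_inv, h1]; rfl⟩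

theorem linear_mem_principalDivisors {p q : k[X]} (h : C.norm p q ≠ 0)
    {R : Multiset C.AffinePoint}
    (hR : ∀ P, C.ordAt (.affine P) (C.linear p q) = effective R (.affine P)) :
    effective R - Finsupp.single Point.infinity ((C.norm p q).natDegree : ℤ)
      ∈ C.principalDivisors := by
  refine mem_principalDivisors_iff.2 (isDivOfFunction_iff.2 ⟨_, linear_ne_zero h, ?_⟩)
  rintro (P | _)
  · rw [hR]; simp
  · rw [ordAt_infinity_linear h]; simp [effective_infinity]

/-- This is the divisor of x - x(P). When P = ιP, the ramification index 2 accounts for the repeated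
point. -/
theorem effective_pair_mem (h2 : (2 : k) ≠ 0) (P : C.AffinePoint) :
    effective {P, P.conj} - Finsupp.single Point.infinity 2 ∈ C.principalDivisors := by
  classical
  have hn : C.norm (X - Polynomial.C P.x) 0 = (X - Polynomial.C P.x) ^ 2 := by simp [norm]
  have h0 : C.norm (X - Polynomial.C P.x) 0 ≠ 0 := by
    rw [hn]; exact pow_ne_zero _ (X_sub_C_ne_zero _)
  have h1 := linear_mem_principalDivisors h0 (R := {P, P.conj}) (by
    intro Q
    have hl : C.linear (X - Polynomial.C P.x) 0 = C.ofPoly (X - Polynomial.C P.x) := by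
      simp [linear]
    rw [hl, ordAt_affine_ofPoly h2 _ (X_sub_C_ne_zero _), effective_affine,
      rootMultiplicity_X_sub_C]
    have hc : Multiset.count Q {P, P.conj}
        = (if Q = P then 1 else 0) + (if Q = P.conj then 1 else 0) := by
      rw [Multiset.insert_eq_cons, Multiset.count_cons, Multiset.count_singleton, add_comm]
    rw [hc]
    by_cases hx : Q.x = P.x
    · rw [if_pos hx]
      by_cases hy : P.y = 0
      · have hP := (AffinePoint.conj_eq_self_iff h2 P).2 hy
        have hQ : Q = P := by
          rcases AffinePoint.eq_or_eq_conj hx with h | h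
          · exact h
          · rw [h, hP]
        simp [hQ, hP, ramification, hy]
      · have hP : P.conj ≠ P := fun h => hy ((AffinePoint.conj_eq_self_iff h2 P).1 h)
        rcases AffinePoint.eq_or_eq_conj hx with h | h
        · simp [h, hP.symm, ramification, hy]
        · simp [h, hP, ramification, hy]
    · have h1 : Q ≠ P := fun h => hx (by rw [h])
      have h3 : Q ≠ P.conj := fun h => hx (by rw [h]; rfl)
      simp [hx, h1, h3])
  rw [hn, natDegree_pow, natDegree_X_sub_C] at h1
  simpa using h1

theorem effective_add_conj_mem (h2 : (2 : k) ≠ 0) (R : Multiset C.AffinePoint) :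
    effective R + effective (R.map AffinePoint.conj)
      - Finsupp.single Point.infinity (2 * R.card : ℤ) ∈ C.principalDivisors := by
  induction R using Multiset.induction with
  | empty => simp [effective]
  | cons P R ih =>
    have h1 := add_mem ih (effective_pair_mem h2 P)
    convert h1 using 1
    rw [Multiset.map_cons, effective_cons, effective_cons, Multiset.insert_eq_cons,
      effective_cons, Multiset.card_cons, ← Multiset.cons_zero, effective_cons]
    push_cast
    rw [mul_add, mul_one, Finsupp.single_add]
    simp only [effective, Multiset.map_zero, Multiset.sum_zero]
    abel

end Principal

end HyperellipticCurve

namespace HyperellipticCurve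

open DoubleCover IsDedekindDomain

variable {k : Type*} [Field k] {g : ℕ} {C : HyperellipticCurve k g}

/-! ### The zeros of `p - q y` -/

/-- The orders of p - qy at P and ιP add up to the order of the norm at P. Summing over fibres of x,
the x-coordinates of the zeros are the roots of the norm with multiplicity. -/
theorem exists_zeros [IsAlgClosed k] [IsDedekindDomain C.CoordRing]
    [IsDedekindDomain C.CoordRingInf] (h2 : (2 : k) ≠ 0) {p q : k[X]} (h : C.norm p q ≠ 0) :
    ∃ R : Multiset C.AffinePoint,
      (∀ P, C.ordAt (.affine P) (C.linear p q) = effective R (.affine P)) ∧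
      R.map AffinePoint.x = (C.norm p q).roots := by
  classical
  choose pt hpt using exists_affinePoint C
  set o : C.AffinePoint → ℕ := fun P => (C.ordAt (.affine P) (C.linear p q)).toNat with ho
  have ho' : ∀ P, C.ordAt (.affine P) (C.linear p q) = o P := fun P =>
    (Int.toNat_of_nonneg (ordAt_affine_linear_nonneg P p q)).symm
  have hsum : ∀ P : C.AffinePoint,
      o P + o P.conj = ramification P.y * (C.norm p q).rootMultiplicity P.x := by
    intro P
    have := ordAt_linear_add_conj h2 P h
    rw [ho', ho'] at this
    exact_mod_cast this
  -- The zeros in the fibre over α; a branch point is its own conjugate and must be listed only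
  -- once.
  set S : k → Multiset C.AffinePoint := fun α =>
    if (pt α).y = 0 then o (pt α) • {pt α}
    else o (pt α) • {pt α} + o (pt α).conj • {(pt α).conj} with hS
  have hmap : ∀ α, (S α).map AffinePoint.x = (C.norm p q).rootMultiplicity α • {α} := by
    intro α
    have h1 := hsum (pt α)
    rw [hpt] at h1
    by_cases hy : (pt α).y = 0
    · rw [(AffinePoint.conj_eq_self_iff h2 _).2 hy] at h1
      simp only [ramification, hy, if_true] at h1
      simp only [hS, hy, if_true, Multiset.map_nsmul, Multiset.map_singleton, hpt]
      congr 1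
      omega
    · simp only [ramification, hy, if_false] at h1
      simp only [hS, hy, if_false, Multiset.map_nsmul, Multiset.map_singleton,
        AffinePoint.conj_x, hpt, Multiset.map_add, ← add_nsmul]
      congr 1
      omega
  have hcount : ∀ α P, (S α).count P = if P.x = α then o P else 0 := by
    intro α P
    by_cases hx : P.x = α
    · rw [if_pos hx]
      have hP : P = pt α ∨ P = (pt α).conj := AffinePoint.eq_or_eq_conj (by rw [hx, hpt])
      by_cases hy : (pt α).y = 0
      · have hP' : P = pt α := by
          rcases hP with hP | hP
          · exact hP
          · rw [hP, (AffinePoint.conj_eq_self_iff h2 _).2 hy]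
        simp [hS, hy, hP']
      · have hne : (pt α).conj ≠ pt α := fun h => hy ((AffinePoint.conj_eq_self_iff h2 _).1 h)
        rcases hP with rfl | rfl
        · simp [hS, hy, hne.symm]
        · simp [hS, hy, hne]
    · rw [if_neg hx]
      have h1 : P ≠ pt α := fun h => hx (by rw [h, hpt])
      have h3 : P ≠ (pt α).conj := fun h => hx (by rw [h, AffinePoint.conj_x, hpt])
      by_cases hy : (pt α).y = 0 <;> simp [hS, hy, h1, h3]
  refine ⟨∑ α ∈ (C.norm p q).roots.toFinset, S α, fun P => ?_, ?_⟩
  · rw [effective_affine, ho', Multiset.count_sum']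
    simp only [hcount]
    rw [Finset.sum_ite_eq]
    split_ifs with hm
    · rfl
    · have h1 := hsum P
      rw [Multiset.mem_toFinset, ← Multiset.count_pos, count_roots] at hm
      rw [show (C.norm p q).rootMultiplicity P.x = 0 by omega] at h1
      simp only [mul_zero] at h1
      have : o P = 0 := by omega
      rw [this]
  · rw [← Multiset.coe_mapAddMonoidHom, map_sum]
    simp only [Multiset.coe_mapAddMonoidHom, hmap, ← count_roots]
    exact Multiset.toFinset_sum_count_nsmul_eq _

/-! ### Reduced divisors -/

-- A branch point occurring twice would be a pair of conjugate summands, so it occurs once; any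
-- other point excludes its conjugate.
open Classical in
theorem count_conj_eq_zero (h2 : (2 : k) ≠ 0) {P : Fin g → C.AffinePoint}
    (hP : ∀ i j, i ≠ j → P i ≠ (P j).conj) {R : C.AffinePoint} (hR : 0 < (points P).count R) :
    (R.y ≠ 0 → (points P).count R.conj = 0) ∧ (R.y = 0 → (points P).count R = 1) := by
  obtain ⟨i, -, hi⟩ := Multiset.mem_map.1 (Multiset.count_pos.1 hR)
  constructor
  · intro hy
    rw [Multiset.count_eq_zero]
    intro hm
    obtain ⟨j, -, hj⟩ := Multiset.mem_map.1 hm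
    have hne : j ≠ i := by
      rintro rfl
      exact hy ((AffinePoint.conj_eq_self_iff h2 R).1 (hj.symm.trans hi))
    exact hP j i hne (by rw [hj, hi])
  · intro hy
    have hc := (AffinePoint.conj_eq_self_iff h2 R).2 hy
    refine le_antisymm ?_ hR
    rw [points, Multiset.count_map, ← Finset.filter_val, Finset.card_val, Finset.card_le_one]
    intro s hs t ht
    by_contra hst
    refine hP s t hst ?_
    rw [← (Finset.mem_filter.1 hs).2, ← (Finset.mem_filter.1 ht).2, hc]

/-- Only P has to be reduced, so this applies to a Q about which nothing is known but its class. -/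
theorem eq_of_reduced [IsAlgClosed k] [IsDedekindDomain C.CoordRing]
    [IsDedekindDomain C.CoordRingInf] (h2 : (2 : k) ≠ 0) {P Q : Fin g → C.AffinePoint}
    (hP : ∀ i j, i ≠ j → P i ≠ (P j).conj) (h : C.jacClass P = C.jacClass Q) :
    points P = points Q := by
  classical
  have hcard : ∀ P : Fin g → C.AffinePoint, (points P).card = g := by intro P; simp [points]
  have hmem : effective (points P) + effective ((points Q).map AffinePoint.conj)
      - Finsupp.single Point.infinity (2 * g : ℤ) ∈ C.principalDivisors := by
    have h1 := add_mem ((jacClass_eq_iff P Q).1 h) (effective_add_conj_mem h2 (points Q))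
    rw [hcard] at h1
    convert h1 using 1
    abel
  obtain ⟨φ, hφ, hord⟩ := isDivOfFunction_iff.1 (mem_principalDivisors_iff.1 hmem)
  have hord' : ∀ R : C.AffinePoint, C.ordAt (.affine R) φ
      = (points P).count R + (points Q).count R.conj := by
    intro R
    rw [hord, Finsupp.sub_apply, Finsupp.add_apply, effective_affine, effective_affine]
    have h1 := Multiset.count_map_eq_count' AffinePoint.conj (points Q)
      AffinePoint.conj_injective R.conj
    rw [AffinePoint.conj_conj] at h1
    rw [h1]
    simp
  -- A function without affine poles is regular on the affine chart, since the primes of a Dedekind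
  -- domain detect integrality and here they are all points.
  obtain ⟨z, rfl⟩ : φ ∈ (algebraMap C.CoordRing C.FunctionField).range := by
    refine HeightOneSpectrum.mem_range_of_ord_nonneg fun v => ?_
    obtain ⟨a, b, hab, hv⟩ := eq_pointIdeal_of_isPrime v.ne_bot v.isPrime
    have hv' : v = prime hab := by ext1; exact hv
    have h1 := hord' ⟨a, b, hab⟩
    rw [hv']
    change 0 ≤ C.ordAt (.affine ⟨a, b, hab⟩) _
    rw [h1]
    positivity
  obtain ⟨r, w, rfl⟩ := exists_eq_add_mul_y C.f z
  have hlin : algebraMap C.CoordRing C.FunctionField (ofX C.f r + ofX C.f w * DoubleCover.y C.f)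
      = C.linear r (-w) := by
    rw [linear_eq_algebraMap]; simp
  rw [hlin] at hφ hord hord'
  have hN : C.norm r (-w) ≠ 0 := by
    refine norm_ne_zero ?_
    by_contra! h0
    exact hφ (by simp [linear, h0.1, h0.2])
  have hdeg : (C.norm r (-w)).natDegree = 2 * g := by
    have h1 := hord .infinity
    rw [ordAt_infinity_linear hN] at h1
    simp [effective_infinity] at h1
    exact_mod_cast h1
  have hw : -w = 0 := by
    by_contra hw
    rw [natDegree_norm_eq_max hw] at hdeg
    have := le_max_right (2 * r.natDegree) (2 * g + 1 + 2 * (-w).natDegree)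
    omega
  rw [hw] at hord' hN
  have hr : r ≠ 0 := by rintro rfl; simp [norm] at hN
  have key : ∀ R : C.AffinePoint, (points P).count R + (points Q).count R.conj
      = ramification R.y * r.rootMultiplicity R.x := by
    intro R
    have h1 := hord' R
    have h3 : C.linear r 0 = C.ofPoly r := by simp [linear]
    rw [h3, ordAt_affine_ofPoly h2 R hr] at h1
    exact_mod_cast h1.symm
  -- It suffices to bound multiplicities. Off the branch points, comparing `key` at R and ιR gives
  -- the bound, as ιR does not occur in P. At a branch point of P the multiplicity in Q is an even
  -- number minus 1, hence at least 1.
  refine Multiset.eq_of_le_of_card_le ?_ (by rw [hcard, hcard])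
  rw [Multiset.le_iff_count]
  intro R
  rcases Nat.eq_zero_or_pos ((points P).count R) with h0 | h0
  · omega
  obtain ⟨h3, h4⟩ := count_conj_eq_zero h2 hP h0
  have h5 := key R
  by_cases hy : R.y = 0
  · rw [(AffinePoint.conj_eq_self_iff h2 R).2 hy] at h5
    have h6 := h4 hy
    simp only [ramification, hy, if_true] at h5
    omega
  · have h6 := h3 hy
    have h7 := key R.conj
    rw [AffinePoint.conj_conj] at h7
    simp only [AffinePoint.conj_x, AffinePoint.conj_y, ramification, neg_eq_zero, hy,
      if_false] at h5 h7
    omega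

end HyperellipticCurve

/-! ### Sums over compositions -/

namespace Composition

variable {R : Type*} [CommRing R]

/-- The sum over the compositions of `n` of the products of the weights of their blocks. -/
def weightSum (c : ℕ → R) (n : ℕ) : R := ∑ σ : Composition n, (σ.blocks.map c).prod

theorem prod_blocksFun {n : ℕ} (σ : Composition n) (c : ℕ → R) :
    ∏ r : Fin σ.length, c (σ.blocksFun r) = (σ.blocks.map c).prod := by
  rw [← σ.ofFn_blocksFun, List.map_ofFn, List.prod_ofFn]
  rfl

theorem weightSum_eq (c : ℕ → R) (n : ℕ) :
    weightSum c n = ∑ σ : Composition n, ∏ r : Fin σ.length, c (σ.blocksFun r) := by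
  simp only [weightSum, prod_blocksFun]

theorem weightSum_zero (c : ℕ → R) : weightSum c 0 = 1 := by
  rw [weightSum, Fintype.sum_eq_single (Composition.ones 0)]
  · simp
  · intro σ hσ
    exact absurd (Composition.ext (by rw [σ.blocks_eq_nil.2 rfl, (ones 0).blocks_eq_nil.2 rfl])) hσ

/-- The composition obtained by prepending a block. -/
def consBlock {n : ℕ} (i : Fin (n + 1)) (τ : Composition (n - i)) : Composition (n + 1) where
  blocks := ((i : ℕ) + 1) :: τ.blocks
  blocks_pos := by
    intro j hj
    rcases List.mem_cons.1 hj with rfl | hj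
    · exact Nat.succ_pos _
    · exact τ.blocks_pos hj
  blocks_sum := by
    rw [List.sum_cons, τ.blocks_sum]
    omega

theorem consBlock_bijective (n : ℕ) : Function.Bijective
    (fun x : Σ i : Fin (n + 1), Composition (n - i) => consBlock x.1 x.2) := by
  constructor
  · rintro ⟨i, τ⟩ ⟨j, τ'⟩ h
    have h1 := congrArg Composition.blocks h
    simp only [consBlock, List.cons.injEq, Nat.add_right_cancel_iff] at h1
    obtain rfl : i = j := Fin.ext h1.1
    obtain rfl : τ = τ' := Composition.ext h1.2
    rfl
  · intro σ
    rcases hb : σ.blocks with _ | ⟨s, l⟩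
    · have := σ.blocks_sum
      rw [hb] at this
      simp at this
    · have hs : 0 < s := σ.blocks_pos (by rw [hb]; simp)
      have hsum := σ.blocks_sum
      rw [hb, List.sum_cons] at hsum
      refine ⟨⟨⟨s - 1, by omega⟩, ⟨l, fun hj => σ.blocks_pos (by rw [hb]; simp [hj]), ?_⟩⟩, ?_⟩
      · simp only; omega
      · ext1
        refine Eq.trans ?_ hb.symm
        simp only [consBlock, List.cons.injEq, and_true]
        omega

/-- Split off the first block. This is the recursion for the coefficients of the inverse of 1 - ∑
c_s t^s. -/
theorem weightSum_succ (c : ℕ → R) (n : ℕ) : weightSum c (n + 1)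
    = ∑ i ∈ Finset.range (n + 1), c (i + 1) * weightSum c (n - i) := by
  rw [weightSum, ← (consBlock_bijective n).sum_comp, Fintype.sum_sigma, Finset.sum_range]
  simp only [consBlock, List.map_cons, List.prod_cons, weightSum, Finset.mul_sum]

end Composition

/-! ### Reduction modulo `u` and `u'` -/

namespace JacobianAddition

open Composition

variable {k : Type*} [Field k]

theorem a_eq (g : ℕ) : a g = g + d g := by simp only [a, d, parity]; omega

theorem d_add_b {g : ℕ} (hg : 0 < g) : d g + 1 + b g = g := by simp only [b, d, parity]; omega

theorem b_le_d (g : ℕ) : b g ≤ d g := by simp only [b, d, parity]; omega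

theorem coeff_mul_X_pow_eq_coeffZ (p : k[X]) (n i : ℕ) :
    (p * X ^ n).coeff i = coeffZ p ((i : ℤ) - n) := by
  rw [coeff_mul_X_pow', coeffZ]
  by_cases h : n ≤ i
  · rw [if_pos h, if_pos (by omega)]
    congr 1; omega
  · rw [if_neg h, if_neg (by omega)]

theorem coeffZ_eq_zero {p : k[X]} {i : ℤ} (h : (p.natDegree : ℤ) < i) : coeffZ p i = 0 := by
  rw [coeffZ, if_pos (by omega)]
  exact coeff_eq_zero_of_natDegree_lt (by omega)

theorem coeffZ_natCast (p : k[X]) (i : ℕ) : coeffZ p (i : ℤ) = p.coeff i := by simp [coeffZ]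

/-- The weights of blocks in `κ`. -/
def kappaWeight (g : ℕ) (u : k[X]) (s : ℕ) : k := -coeffZ u ((g : ℤ) - s)

theorem kappa_eq (g : ℕ) (u : k[X]) (i l : ℕ) : kappa g u i l =
    ∑ m ∈ Finset.Icc l (d g),
      coeffZ u ((i : ℤ) - d g + m) * weightSum (kappaWeight g u) (m - l) := by
  simp only [kappa, weightSum_eq, kappaWeight, Finset.prod_neg, Finset.card_univ,
    Fintype.card_fin]

/-- The polynomial of degree less than `g` with given coefficients. -/
def low (g : ℕ) : (ℕ → k) →ₗ[k] k[X] where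
  toFun c := ∑ i ∈ Finset.range g, Polynomial.C (c i) * X ^ i
  map_add' c c' := by simp [add_mul, Finset.sum_add_distrib]
  map_smul' r c := by simp [Finset.mul_sum, mul_assoc, smul_eq_C_mul]

theorem low_apply (g : ℕ) (c : ℕ → k) :
    low g c = ∑ i ∈ Finset.range g, Polynomial.C (c i) * X ^ i := rfl

theorem coeff_low (g : ℕ) (c : ℕ → k) (i : ℕ) :
    (low g c).coeff i = if i < g then c i else 0 := by
  simp [low_apply, finsetSum_coeff, coeff_X_pow]

/-- In this range the sum is a full convolution of the reversed coefficients of u with those of the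
inverse series, hence a Kronecker delta. -/
theorem kappa_of_ge {g : ℕ} {u : k[X]} (hu : u.Monic) (hd : u.natDegree = g) {e l : ℕ}
    (hl : l ≤ d g) : kappa g u (g + e) l = if e = d g - l then 1 else 0 := by
  rw [kappa_eq]
  set w := weightSum (kappaWeight g u) with hw
  have hre : ∑ m ∈ Finset.Icc l (d g), coeffZ u (((g + e : ℕ) : ℤ) - d g + m) * w (m - l)
      = ∑ n ∈ Finset.range (d g + 1 - l), coeffZ u ((g : ℤ) + e - d g + l + n) * w n := by
    rw [← Finset.Ico_add_one_right_eq_Icc, Finset.sum_Ico_eq_sum_range]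
    refine Finset.sum_congr rfl fun n _ => ?_
    rw [Nat.add_sub_cancel_left]
    congr 2
    push_cast; ring
  rw [hre]
  by_cases he : e ≤ d g - l
  -- Terms with n > T involve coefficients of u beyond its degree. The term n = T has the leading
  -- coefficient 1 and cancels the others by the recursion.
  · obtain ⟨T, hT⟩ : ∃ T, d g - l = e + T := ⟨d g - l - e, by omega⟩
    have hsub : Finset.range (T + 1) ⊆ Finset.range (d g + 1 - l) :=
      Finset.range_subset_range.2 (by omega)
    rw [← Finset.sum_subset hsub (fun n _ hn => by
      rw [Finset.mem_range] at hn
      rw [coeffZ_eq_zero (by rw [hd]; omega), zero_mul]), Finset.sum_range_succ]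
    have hlast : coeffZ u ((g : ℤ) + e - d g + l + T) = 1 := by
      rw [show (g : ℤ) + e - d g + l + T = (u.natDegree : ℤ) by omega, coeffZ_natCast]
      exact hu
    rw [hlast, one_mul]
    rcases T with _ | T
    · rw [if_pos (by omega)]
      simp [hw, weightSum_zero]
    · rw [if_neg (by omega), hw, weightSum_succ, ← hw, ← Finset.sum_range_reflect,
        ← Finset.sum_add_distrib]
      refine Finset.sum_eq_zero fun n hn => ?_
      rw [Finset.mem_range] at hn
      rw [kappaWeight, show T + 1 - 1 - n = T - n by omega,
        show (g : ℤ) + e - d g + l + (T - n : ℕ) = g - (n + 1 : ℕ) by omega]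
      ring
  · rw [if_neg (by omega)]
    refine Finset.sum_eq_zero fun n _ => ?_
    rw [coeffZ_eq_zero (by rw [hd]; omega), zero_mul]

/-- `x ^ (a - ℓ) + ∑ κ_{i,ℓ} x ^ i` -/
def kappaPoly (g : ℕ) (u : k[X]) (l : ℕ) : k[X] :=
  X ^ (g + (d g - l)) + low g fun i => kappa g u i l

theorem dvd_kappaPoly {g : ℕ} {u : k[X]} (hu : u.Monic) (hd : u.natDegree = g) {l : ℕ}
    (hl : l ≤ d g) : u ∣ kappaPoly g u l := by
  -- The cofactor is the polynomial part of x^{a-ℓ} / u.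
  refine ⟨∑ m ∈ Finset.Icc l (d g),
    Polynomial.C (weightSum (kappaWeight g u) (m - l)) * X ^ (d g - m), ?_⟩
  have hk : ∀ i, (u * ∑ m ∈ Finset.Icc l (d g),
      Polynomial.C (weightSum (kappaWeight g u) (m - l)) * X ^ (d g - m)).coeff i
      = kappa g u i l := by
    intro i
    rw [kappa_eq, Finset.mul_sum, finsetSum_coeff]
    refine Finset.sum_congr rfl fun m hm => ?_
    rw [Finset.mem_Icc] at hm
    rw [mul_left_comm, coeff_C_mul, coeff_mul_X_pow_eq_coeffZ, mul_comm]
    congr 2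
    omega
  ext i
  rw [hk, kappaPoly, coeff_add, coeff_low, coeff_X_pow]
  by_cases hi : i < g
  · rw [if_pos hi, if_neg (by omega), zero_add]
  · obtain ⟨e, rfl⟩ := Nat.exists_eq_add_of_le (not_lt.1 hi)
    rw [if_neg hi, kappa_of_ge hu hd hl, add_zero]
    simp

/-- `x ^ j v + ∑ λ_{i,j} x ^ i` -/
def lamPoly (g : ℕ) (u v : k[X]) (j : ℕ) : k[X] :=
  v * X ^ j + low g fun i => lam g u v i j

theorem dvd_lamPoly {g : ℕ} {u v : k[X]} (hu : u.Monic) (hd : u.natDegree = g)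
    (hv : v.degree < g) {j : ℕ} (hj : j ≤ b g) : u ∣ lamPoly g u v j := by
  -- Since j ≤ b ≤ d, the terms of x^j v of degree at least g have degree at most a, and each is
  -- cleared by one `kappaPoly`.
  have key : lamPoly g u v j = ∑ l ∈ Finset.range (d g + 1),
      Polynomial.C (coeffZ v ((a g : ℤ) - j - l)) * kappaPoly g u l := by
    ext i
    rw [lamPoly, coeff_add, coeff_low, coeff_mul_X_pow_eq_coeffZ, finsetSum_coeff]
    simp only [coeff_C_mul, kappaPoly, coeff_add, coeff_low, coeff_X_pow]
    by_cases hi : i < g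
    · rw [if_pos hi, lam, add_neg_cancel_left]
      refine Finset.sum_congr rfl fun l _ => ?_
      rw [if_neg (by omega), if_pos hi, zero_add]
    · simp only [if_neg hi, add_zero]
      have := b_le_d g
      by_cases hi' : i ≤ a g
      · rw [Finset.sum_eq_single_of_mem (a g - i) (by
          rw [Finset.mem_range, a_eq] at *; omega)]
        · rw [if_pos (by rw [a_eq] at *; omega), mul_one]
          congr 1; omega
        · intro l hl hne
          rw [Finset.mem_range] at hl
          rw [if_neg (by rw [a_eq] at *; omega), mul_zero]
      · rw [a_eq] at hi'
        rw [Finset.sum_eq_zero fun l hl => by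
          rw [Finset.mem_range] at hl
          rw [if_neg (by omega), mul_zero]]
        rw [coeffZ, if_pos (by omega)]
        exact coeff_eq_zero_of_degree_lt (hv.trans_le (by
          exact_mod_cast (by omega : g ≤ ((i : ℤ) - j).toNat)))
  rw [key]
  refine Finset.dvd_sum fun l hl => Dvd.dvd.mul_left (dvd_kappaPoly hu hd ?_) _
  rw [Finset.mem_range] at hl
  omega

/-! ### The determinant formulas -/

theorem sum_Icc_one_eq {M : Type*} [AddCommMonoid M] (n : ℕ) (F : ℕ → M) :
    ∑ j ∈ Finset.Icc 1 n, F j = ∑ j ∈ Finset.range n, F (j + 1) := by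
  rw [← Finset.Ico_add_one_right_eq_Icc, Finset.sum_Ico_eq_sum_range]
  simp [add_comm]

/-- The low coefficients of `detP`, computed with the pair `(u, v)`. -/
def lowCoeff (g : ℕ) (u v u' v' w z : k[X]) (i : ℕ) : k :=
  (∑ l ∈ Finset.range (d g + 1), detM g u v u' v' (d g - l) * kappa g w i l)
    - (∑ j ∈ Finset.Icc 1 (b g), detM g u v u' v' (d g + j) * lam g w z i j)
    - (matM g u v u' v').det * lam g w z i 0

/-- This is the i-th row of Cramer's identity: column c ≤ d carries p_{g+c}, column d + j carries
q_j. -/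
theorem lowCoeff_eq {g : ℕ} (hg : 0 < g) (u v u' v' : k[X]) {i : ℕ} (hi : i < g) :
    lowCoeff g u v u' v' u v i = lowCoeff g u v u' v' u' v' i := by
  have h1 := congrFun (Matrix.mulVec_cramer (matM g u v u' v') (rhs g u v u' v')) ⟨i, hi⟩
  set D := detM g u v u' v' with hD
  have h3 : ∑ c ∈ Finset.range g, (if c ≤ d g then kappa g u i (d g - c) - kappa g u' i (d g - c)
      else lam g u' v' i (c - d g) - lam g u v i (c - d g)) * D c
      = (matM g u v u' v').det * (lam g u v i 0 - lam g u' v' i 0) := by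
    rw [Finset.sum_range]
    refine Eq.trans (Finset.sum_congr rfl fun c _ => ?_) h1
    rw [hD, detM, dif_pos c.2, Matrix.cramer_apply]
    rfl
  rw [show Finset.range g = Finset.range (d g + 1 + b g) by rw [d_add_b hg],
    Finset.sum_range_add, ← Finset.sum_range_reflect] at h3
  simp only [lowCoeff, sum_Icc_one_eq]
  have h4 : ∑ l ∈ Finset.range (d g + 1), D (d g - l) * kappa g u i l
      - ∑ l ∈ Finset.range (d g + 1), D (d g - l) * kappa g u' i l
      = ∑ j ∈ Finset.range (d g + 1), (if d g + 1 - 1 - j ≤ d g then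
        kappa g u i (d g - (d g + 1 - 1 - j)) - kappa g u' i (d g - (d g + 1 - 1 - j))
        else lam g u' v' i (d g + 1 - 1 - j - d g) - lam g u v i (d g + 1 - 1 - j - d g))
        * D (d g + 1 - 1 - j) := by
    rw [← Finset.sum_sub_distrib]
    refine Finset.sum_congr rfl fun l hl => ?_
    rw [Finset.mem_range] at hl
    rw [if_pos (by omega), show d g - (d g + 1 - 1 - l) = l by omega, Nat.add_sub_cancel]
    ring
  have h5 : ∑ j ∈ Finset.range (b g), D (d g + (j + 1)) * lam g u' v' i (j + 1)
      - ∑ j ∈ Finset.range (b g), D (d g + (j + 1)) * lam g u v i (j + 1)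
      = ∑ x ∈ Finset.range (b g), (if d g + 1 + x ≤ d g then
        kappa g u i (d g - (d g + 1 + x)) - kappa g u' i (d g - (d g + 1 + x))
        else lam g u' v' i (d g + 1 + x - d g) - lam g u v i (d g + 1 + x - d g))
        * D (d g + 1 + x) := by
    rw [← Finset.sum_sub_distrib]
    refine Finset.sum_congr rfl fun x hx => ?_
    rw [if_neg (by omega), show d g + 1 + x - d g = x + 1 by omega,
      show d g + (x + 1) = d g + 1 + x by omega]
    ring
  rw [← h4, ← h5] at h3
  linear_combination h3

theorem low_congr {g : ℕ} {c c' : ℕ → k} (h : ∀ i < g, c i = c' i) : low g c = low g c' := by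
  ext i
  rw [coeff_low, coeff_low]
  split_ifs with hi
  exacts [h i hi, rfl]

theorem detP_eq (g : ℕ) (u v u' v' : k[X]) :
    detP g u v u' v' = low g (lowCoeff g u v u' v' u v)
      + ∑ l ∈ Finset.range (d g + 1),
        Polynomial.C (detM g u v u' v' (d g - l)) * X ^ (g + (d g - l)) := by
  rw [detP, ← Finset.sum_range_reflect _ (d g + 1)]
  rfl

/-- The pair (w, z) is kept free so that the same expansion of p - qz into multiples of w serves
both (u, v) and (u', v'). -/
theorem low_lowCoeff_eq (g : ℕ) (u v u' v' w z : k[X]) :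
    low g (lowCoeff g u v u' v' w z)
      + ∑ l ∈ Finset.range (d g + 1),
        Polynomial.C (detM g u v u' v' (d g - l)) * X ^ (g + (d g - l))
      - detQ g u v u' v' * z
    = ∑ l ∈ Finset.range (d g + 1), Polynomial.C (detM g u v u' v' (d g - l)) * kappaPoly g w l
      - ∑ j ∈ Finset.Icc 1 (b g), Polynomial.C (detM g u v u' v' (d g + j)) * lamPoly g w z j
      - Polynomial.C (matM g u v u' v').det * lamPoly g w z 0 := by
  have h1 : lowCoeff g u v u' v' w z =
      (∑ l ∈ Finset.range (d g + 1), detM g u v u' v' (d g - l) • fun i => kappa g w i l)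
      - (∑ j ∈ Finset.Icc 1 (b g), detM g u v u' v' (d g + j) • fun i => lam g w z i j)
      - (matM g u v u' v').det • fun i => lam g w z i 0 := by
    funext i
    simp [lowCoeff]
  rw [h1, map_sub, map_sub, map_sum, map_sum]
  simp only [map_smul, kappaPoly, lamPoly, detQ, mul_add, Finset.sum_add_distrib, smul_eq_C_mul,
    add_mul, Finset.sum_mul, pow_zero, mul_comm z]
  simp only [mul_assoc]
  ring

theorem interpolates_det {g : ℕ} (hg : 0 < g) {u v u' v' : k[X]} (hu : u.Monic)
    (hd : u.natDegree = g) (hv : v.degree < g) (hu' : u'.Monic) (hd' : u'.natDegree = g)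
    (hv' : v'.degree < g) :
    Interpolates g u v u' v' (detP g u v u' v') (detQ g u v u' v') := by
  have key : ∀ w z : k[X], w.Monic → w.natDegree = g → z.degree < g →
      w ∣ low g (lowCoeff g u v u' v' w z) + ∑ l ∈ Finset.range (d g + 1),
        Polynomial.C (detM g u v u' v' (d g - l)) * X ^ (g + (d g - l))
        - detQ g u v u' v' * z := by
    intro w z hw hwd hz
    rw [low_lowCoeff_eq]
    refine dvd_sub (dvd_sub (Finset.dvd_sum fun l hl => ?_) (Finset.dvd_sum fun j hj => ?_)) ?_
    · rw [Finset.mem_range] at hl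
      exact Dvd.dvd.mul_left (dvd_kappaPoly hw hwd (by omega)) _
    · exact Dvd.dvd.mul_left (dvd_lamPoly hw hwd hz (Finset.mem_Icc.1 hj).2) _
    · exact Dvd.dvd.mul_left (dvd_lamPoly hw hwd hz (Nat.zero_le _)) _
  refine ⟨?_, ?_, ?_, ?_⟩
  · rw [detP]
    refine natDegree_add_le_of_degree_le (natDegree_sum_le_of_forall_le _ _ fun i hi => ?_)
      (natDegree_sum_le_of_forall_le _ _ fun i hi => ?_)
    all_goals
      rw [Finset.mem_range] at hi
      refine (natDegree_C_mul_X_pow_le _ _).trans ?_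
      rw [a_eq]
      omega
  · rw [detQ]
    refine natDegree_add_le_of_degree_le (by rw [natDegree_C]; exact Nat.zero_le _)
      (natDegree_sum_le_of_forall_le _ _ fun j hj => ?_)
    exact (natDegree_C_mul_X_pow_le _ _).trans (Finset.mem_Icc.1 hj).2
  · rw [detP_eq]
    exact key u v hu hd hv
  · rw [detP_eq, low_congr fun i hi => lowCoeff_eq hg u v u' v' hi]
    exact key u' v' hu' hd' hv'

end JacobianAddition

namespace JacobianAddition

open Composition HyperellipticCurve

variable {k : Type*} [Field k]

/-! ### The coefficients of `u''` -/

theorem omega_eq (u u' : k[X]) (j : ℕ) : omega u u' j = (u * u').coeff j := by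
  rw [coeff_mul, Finset.Nat.sum_antidiagonal_eq_sum_range_succ_mk]
  rfl

theorem eta_eq (f p q : k[X]) (n : ℕ) : eta f p q n = (p ^ 2 - f * q ^ 2).coeff n := by
  rw [coeff_sub, sq p, mul_comm f, coeff_mul, coeff_mul,
    Finset.Nat.sum_antidiagonal_eq_sum_range_succ_mk,
    Finset.Nat.sum_antidiagonal_eq_sum_range_succ_mk, ← Finset.sum_sub_distrib, eta]
  refine Finset.sum_congr rfl fun j _ => ?_
  rw [sq q, coeff_mul, Finset.Nat.sum_antidiagonal_eq_sum_range_succ_mk, mul_comm (f.coeff _)]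

/-- The weights -A_s / A_0 make the composition sums the coefficients of A_0 / A, so exact division
by A can be done on power series. -/
theorem mul_weightSum_series {A : k[X]} (h0 : A.coeff 0 ≠ 0) :
    (A : PowerSeries k) * PowerSeries.mk (weightSum fun s => -(A.coeff s / A.coeff 0))
      = PowerSeries.C (A.coeff 0) := by
  ext n
  rw [PowerSeries.coeff_mul, Finset.Nat.sum_antidiagonal_eq_sum_range_succ_mk]
  simp only [Polynomial.coeff_coe, PowerSeries.coeff_mk, PowerSeries.coeff_C]
  rcases n with _ | n
  · simp [weightSum_zero]
  · rw [Finset.sum_range_succ', Nat.sub_zero, weightSum_succ, Finset.mul_sum,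
      ← Finset.sum_add_distrib, if_neg (Nat.succ_ne_zero n)]
    refine Finset.sum_eq_zero fun i _ => ?_
    rw [Nat.add_sub_add_right]
    field_simp
    ring

theorem coeff_eq_of_mul_eq {A B N : k[X]} {r : k} (hr : r ≠ 0) (h0 : A.coeff 0 ≠ 0)
    (h : N = Polynomial.C r * A * B) (j : ℕ) :
    B.coeff j = ∑ i ∈ Finset.range (j + 1), N.coeff i / (r * A.coeff 0) *
      weightSum (fun s => -(A.coeff s / A.coeff 0)) (j - i) := by
  have h1 : (N : PowerSeries k) * PowerSeries.mk (weightSum fun s => -(A.coeff s / A.coeff 0))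
      = PowerSeries.C (r * A.coeff 0) * (B : PowerSeries k) := by
    rw [h, Polynomial.coe_mul, Polynomial.coe_mul, Polynomial.coe_C, mul_right_comm,
      mul_assoc (PowerSeries.C r), mul_weightSum_series h0, map_mul]
  have h2 := congrArg (PowerSeries.coeff j) h1
  rw [PowerSeries.coeff_mul, Finset.Nat.sum_antidiagonal_eq_sum_range_succ_mk,
    PowerSeries.coeff_C_mul] at h2
  simp only [Polynomial.coeff_coe, PowerSeries.coeff_mk] at h2
  have h3 : r * A.coeff 0 ≠ 0 := mul_ne_zero hr h0
  rw [← mul_right_inj' h3, ← h2, Finset.mul_sum]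
  refine Finset.sum_congr rfl fun i _ => ?_
  field_simp

theorem sum_omega_eq (A : k[X]) (n : ℕ) :
    ∑ σ : Composition n, (-1) ^ σ.length / A.coeff 0 ^ σ.length *
      ∏ r : Fin σ.length, A.coeff (σ.blocksFun r)
      = weightSum (fun s => -(A.coeff s / A.coeff 0)) n := by
  rw [weightSum_eq]
  refine Finset.sum_congr rfl fun σ _ => ?_
  rw [Finset.prod_neg, Finset.prod_div_distrib, Finset.prod_const, Finset.card_univ,
    Fintype.card_fin]
  ring

/-! ### The degree of the norm -/

theorem coeff_norm {g : ℕ} (hg : 0 < g) (C : HyperellipticCurve k g) {p q : k[X]}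
    (hp : p.natDegree ≤ a g) (hq : q.natDegree ≤ b g) :
    (C.norm p q).natDegree ≤ 3 * g ∧ (C.norm p q).coeff (3 * g) = rho g C.f p q := by
  have hp2 : (p ^ 2).natDegree ≤ a g + a g := by
    rw [sq]; exact natDegree_mul_le_of_le hp hp
  have hq2 : (q ^ 2).natDegree ≤ b g + b g := by
    rw [sq]; exact natDegree_mul_le_of_le hq hq
  have hf2 : (C.f * q ^ 2).natDegree ≤ (2 * g + 1) + (b g + b g) :=
    natDegree_mul_le_of_le C.natDegree_eq.le hq2
  have hpc : (p ^ 2).coeff (a g + a g) = p.coeff (a g) ^ 2 := by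
    rw [sq, coeff_mul_add_eq_of_natDegree_le hp hp, sq]
  have hqc : (q ^ 2).coeff (b g + b g) = q.coeff (b g) ^ 2 := by
    rw [sq, coeff_mul_add_eq_of_natDegree_le hq hq, sq]
  have hfc : (C.f * q ^ 2).coeff ((2 * g + 1) + (b g + b g))
      = C.f.coeff (2 * g + 1) * q.coeff (b g) ^ 2 := by
    rw [coeff_mul_add_eq_of_natDegree_le C.natDegree_eq.le hq2, hqc]
  -- Exactly one of p^2 and f q^2 can reach degree 3g: the former for even g, the latter for odd g.
  -- For g = 0 the truncated subtraction in `b` would break this.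
  have hpar : parity g = 0 ∧ a g + a g = 3 * g ∧ (2 * g + 1) + (b g + b g) < 3 * g ∨
      parity g = 1 ∧ a g + a g < 3 * g ∧ (2 * g + 1) + (b g + b g) = 3 * g := by
    simp only [a, b, parity]; omega
  rw [HyperellipticCurve.norm, rho]
  rcases hpar with ⟨h0, h1, h2⟩ | ⟨h0, h1, h2⟩
  · refine ⟨(natDegree_sub_le_of_le hp2 hf2).trans (max_le h1.le h2.le), ?_⟩
    rw [coeff_sub, ← h1, hpc, coeff_eq_zero_of_natDegree_lt (p := C.f * q ^ 2) (by omega), h0]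
    simp
  · refine ⟨(natDegree_sub_le_of_le hp2 hf2).trans (max_le h1.le h2.le), ?_⟩
    rw [coeff_sub, ← h2, hfc, coeff_eq_zero_of_natDegree_lt (p := p ^ 2) (by omega), h0]
    simp

end JacobianAddition

namespace HyperellipticCurve

variable {k : Type*} [Field k] {g : ℕ} {C : HyperellipticCurve k g}

/-! ### The interpolation function -/

theorem Represents.monic {P : Fin g → C.AffinePoint} {u v : k[X]} (h : C.Represents P u v) :
    u.Monic := by
  rw [h.u_eq]; exact monic_prod_X_sub_C _ _

theorem Represents.natDegree {P : Fin g → C.AffinePoint} {u v : k[X]} (h : C.Represents P u v) :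
    u.natDegree = g := by
  rw [h.u_eq, natDegree_finsetProd_X_sub_C_eq_card, Finset.card_univ, Fintype.card_fin]

theorem roots_prod_X_sub (R : Multiset C.AffinePoint) :
    (R.map fun P : C.AffinePoint => X - Polynomial.C P.x).prod.roots = R.map AffinePoint.x := by
  have := roots_multiset_prod_X_sub_C (R.map AffinePoint.x)
  rwa [Multiset.map_map] at this

open Classical in
theorem count_le_ordAt_linear [IsDedekindDomain C.CoordRing] [IsDedekindDomain C.CoordRingInf]
    (h2 : (2 : k) ≠ 0) {P : Fin g → C.AffinePoint} {u v p q : k[X]} (h : C.Represents P u v)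
    (hpq : u ∣ p - q * v) (hN : C.norm p q ≠ 0) (R : C.AffinePoint) (hR : R ∈ points P) :
    ((points P).count R : ℤ) ≤ C.ordAt (.affine R) (C.linear p q) := by
  obtain ⟨i, -, rfl⟩ := Multiset.mem_map.1 hR
  obtain ⟨n, hn, hn'⟩ := h.v_approx i
  rw [sumDivisor_eq_effective, effective_affine] at hn
  obtain ⟨h0, rfl⟩ := (C.hasOrd_iff _ _ _).1 hn'
  have hsplit : C.linear p q = C.ofPoly (p - q * v) + C.ofPoly q * (C.ofPoly v - C.y) := by
    simp only [linear, map_sub, map_mul]; ring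
  have hne := linear_ne_zero hN
  rw [hsplit] at hne ⊢
  refine le_ordAt_add _ hne ?_ ?_
  · by_cases hz : p - q * v = 0
    · left; rw [hz, map_zero]
    · right
      rw [ordAt_affine_ofPoly h2 _ hz]
      -- Every occurrence of the point contributes a factor to u, which divides p - qv; ramification
      -- can only raise the order.
      have h3 : (points P).count (P i) ≤ (p - q * v).rootMultiplicity (P i).x := by
        rw [← count_roots]
        refine le_trans ?_ (Multiset.count_le_of_le _ (roots.le_of_dvd hz hpq))
        rw [h.u_eq, prod_X_sub_eq, roots_prod_X_sub]
        generalize points P = R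
        rw [Multiset.count_map, Multiset.count_eq_card_filter_eq]
        exact Multiset.card_le_card (Multiset.monotone_filter_right _ fun S (hS : P i = S) => by rw [hS])
      have h4 : 1 ≤ DoubleCover.ramification (P i).y := by
        unfold DoubleCover.ramification; split_ifs <;> norm_num
      exact_mod_cast h3.trans (Nat.le_mul_of_pos_left _ h4)
  · by_cases hz : q = 0
    · left; rw [hz, map_zero, zero_mul]
    · right
      rw [ordAt_mul _ (ofPoly_ne_zero hz) h0, ordAt_affine_ofPoly h2 _ hz]
      have : (0 : ℤ) ≤ DoubleCover.ramification (P i).y * q.rootMultiplicity (P i).x := by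
        positivity
      omega

theorem exists_sum [IsAlgClosed k] (h2 : (2 : k) ≠ 0) {P P' : Fin g → C.AffinePoint}
    {u v u' v' p q : k[X]} (h : C.Represents P u v) (h' : C.Represents P' u' v')
    (hx : ∀ i j, (P i).x ≠ (P' j).x) (hpq : u ∣ p - q * v) (hpq' : u' ∣ p - q * v')
    (hdeg : (C.norm p q).natDegree = 3 * g) (hN : C.norm p q ≠ 0) :
    ∃ Q : Fin g → C.AffinePoint,
      C.norm p q = Polynomial.C (C.norm p q).leadingCoeff * u * u'
        * ∏ i, (X - Polynomial.C (Q i).x) ∧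
      C.jacClass P + C.jacClass P' = C.jacClass Q := by
  classical
  have := C.isDedekindDomain_coordRing h2
  have := C.isDedekindDomain_coordRingInf h2
  obtain ⟨R, hR, hroots⟩ := exists_zeros h2 hN
  -- No point lies in both supports, so the two vanishing conditions never have to be added at one
  -- point.
  have hle : points P + points P' ≤ R := by
    rw [Multiset.le_iff_count]
    intro S
    rw [Multiset.count_add]
    have hS := hR S
    rw [effective_affine] at hS
    by_cases hm : S ∈ points P
    · have hm' : S ∉ points P' := by
        intro hm'
        obtain ⟨i, -, hi⟩ := Multiset.mem_map.1 hm
        obtain ⟨j, -, hj⟩ := Multiset.mem_map.1 hm'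
        exact hx i j (by rw [hi, hj])
      have h1 := count_le_ordAt_linear h2 h hpq hN S hm
      rw [Multiset.count_eq_zero_of_notMem hm']
      omega
    · rw [Multiset.count_eq_zero_of_notMem hm, zero_add]
      by_cases hm' : S ∈ points P'
      · have h1 := count_le_ordAt_linear h2 h' hpq' hN S hm'
        omega
      · rw [Multiset.count_eq_zero_of_notMem hm']
        exact Nat.zero_le _
  obtain ⟨E, rfl⟩ := Multiset.le_iff_exists_add.1 hle
  have hcardR : (points P + points P' + E).card = 3 * g := by
    rw [← hdeg, (IsAlgClosed.splits (C.norm p q)).natDegree_eq_card_roots, ← hroots,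
      Multiset.card_map]
  have hcard : E.card = g := by
    simp only [Multiset.card_add, points, Multiset.card_map, Finset.card_val, Finset.card_univ,
      Fintype.card_fin] at hcardR
    omega
  -- Conjugating the residual zeros E negates their class and keeps their x-coordinates.
  obtain ⟨Q, hQ : points Q = _⟩ := exists_fin_map_eq (R := E.map AffinePoint.conj)
    ((Multiset.card_map _ _).trans hcard)
  refine ⟨Q, ?_, ?_⟩
  · conv_lhs => rw [(IsAlgClosed.splits (C.norm p q)).eq_prod_roots, ← hroots]
    rw [h.u_eq, h'.u_eq, prod_X_sub_eq, prod_X_sub_eq, prod_X_sub_eq, hQ]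
    simp only [Multiset.map_add, Multiset.prod_add, Multiset.map_map, Function.comp_def,
      AffinePoint.conj_x]
    ring
  · rw [jacClass_add_eq_iff, hQ]
    have h1 := linear_mem_principalDivisors hN hR
    have h3 := sub_mem h1 (effective_add_conj_mem h2 E)
    rw [hdeg, hcard] at h3
    convert h3 using 1
    rw [effective_add, effective_add]
    have h4 : Finsupp.single (Point.infinity : C.Point) ((3 * g : ℕ) : ℤ)
        = Finsupp.single Point.infinity (g : ℤ) + Finsupp.single Point.infinity (2 * g : ℤ) := by
      rw [← Finsupp.single_add]; congr 1; push_cast; ring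
    rw [h4]
    abel

end HyperellipticCurve

end

/-! ### The addition theorem -/

theorem mainTheorem3 {k : Type*} [Field k] [IsAlgClosed k] (hchar : ringChar k ≠ 2)
    (g : ℕ) (hg : 0 < g) (C : HyperellipticCurve k g)
    (P P' : Fin g → C.AffinePoint) (u v u' v' : Polynomial k)
    (hD : C.Represents P u v) (hD' : C.Represents P' u' v')
    (hx : ∀ i j, (P i).x ≠ (P' j).x) :
    JacobianAddition.Interpolates g u v u' v'
      (JacobianAddition.detP g u v u' v') (JacobianAddition.detQ g u v u' v') ∧
    ∀ p q : Polynomial k, JacobianAddition.Interpolates g u v u' v' p q →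
      JacobianAddition.rho g C.f p q ≠ 0 →
      ∃ u'' : Polynomial k,
        p ^ 2 - C.f * q ^ 2
          = Polynomial.C (JacobianAddition.rho g C.f p q) * u * u' * u'' ∧
        u''.Monic ∧ u''.natDegree = g ∧
        (∃ Q : Fin g → C.AffinePoint,
          C.jacClass P + C.jacClass P' = C.jacClass Q ∧
          u'' = ∏ i, (Polynomial.X - Polynomial.C (Q i).x)) ∧
        (∀ (P'' : Fin g → C.AffinePoint) (u₂ v₂ : Polynomial k),
          C.Represents P'' u₂ v₂ → C.jacClass P + C.jacClass P' = C.jacClass P'' →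
          u₂ = u'') ∧
        (JacobianAddition.omega u u' 0 ≠ 0 → ∀ j : ℕ,
          u''.coeff j = ∑ i ∈ Finset.range (j + 1),
            JacobianAddition.eta C.f p q i /
                (JacobianAddition.rho g C.f p q * JacobianAddition.omega u u' 0) *
              ∑ σ : Composition (j - i),
                (-1) ^ σ.length / JacobianAddition.omega u u' 0 ^ σ.length *
                  ∏ r : Fin σ.length, JacobianAddition.omega u u' (σ.blocksFun r)) := by
  have h2 : (2 : k) ≠ 0 := Ring.two_ne_zero hchar
  refine ⟨JacobianAddition.interpolates_det hg hD.monic hD.natDegree hD.v_degree hD'.monic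
    hD'.natDegree hD'.v_degree, fun p q hpq hrho => ?_⟩
  obtain ⟨hle, hcoeff⟩ := JacobianAddition.coeff_norm hg C hpq.p_deg hpq.q_deg
  have hdeg : (C.norm p q).natDegree = 3 * g :=
    le_antisymm hle (Polynomial.le_natDegree_of_ne_zero (by rwa [hcoeff]))
  have hN : C.norm p q ≠ 0 := by
    intro h0
    rw [h0, Polynomial.coeff_zero] at hcoeff
    exact hrho hcoeff.symm
  have hlead : (C.norm p q).leadingCoeff = JacobianAddition.rho g C.f p q := by
    rw [Polynomial.leadingCoeff, hdeg, hcoeff]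
  obtain ⟨Q, hQ, hjac⟩ := C.exists_sum h2 hD hD' hx hpq.dvd hpq.dvd' hdeg hN
  rw [hlead] at hQ
  refine ⟨_, hQ, Polynomial.monic_prod_X_sub_C _ _, ?_, ⟨Q, hjac, rfl⟩, ?_, ?_⟩
  · rw [Polynomial.natDegree_finsetProd_X_sub_C_eq_card, Finset.card_univ, Fintype.card_fin]
  · intro P'' u₂ v₂ hrep hcls
    have := C.isDedekindDomain_coordRing h2
    have := C.isDedekindDomain_coordRingInf h2
    rw [hrep.u_eq, HyperellipticCurve.prod_X_sub_eq, HyperellipticCurve.prod_X_sub_eq,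
      HyperellipticCurve.eq_of_reduced h2 hrep.not_conj (hcls.symm.trans hjac)]
  · intro hom j
    simp only [JacobianAddition.omega_eq, JacobianAddition.eta_eq] at hom ⊢
    simp only [JacobianAddition.sum_omega_eq]
    exact JacobianAddition.coeff_eq_of_mul_eq hrho hom (by rw [← mul_assoc]; exact hQ) j
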